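/- Let $q$ be the dimension, $n>0$ real, and $S,F$ real $q\times q$ matrices. The inverse Wishart distribution $\mathrm{IW}_p(\delta,D)$ has density proportional to $|M|^{-(\delta+2p)/2}\exp\{-\tfrac12\mathrm{tr}(DM^{-1})\}$ on positive definite $p\times p$ matrices. The IW-AR(1) process with parameters $(n,S,F)$ is the stationary first-order Markov process $(\Sigma_t)_{t\ge 0}$ of $q\times q$ positive definite matrices such that, for each $t\ge1$, $(\Sigma_{t-1},\Sigma_t)$ is distributed as the pair of diagonal blocks of $$\begin{pmatrix}\Sigma_{t-1}&\phi_t'\\ \phi_t&\Sigma_t\end{pmatrix}\sim \mathrm{IW}_{2q}\left(n+2,\; n\begin{pmatrix}S&SF'\\FS&S\end{pmatrix}\right).$$ Its transition law from $\Sigma_{t-1}=A$ is the law of $\Sigma_t$ under the conditional density of $(\phi_t,\Sigma_t)$ given $\Sigma_{t-1}=A$, and $E[\Sigma_t\mid\Sigma_0=A]$ denotes the mean of $\Sigma_t$ under the chain started at $A$ with these transitions, which is a version of the conditional expectation $E[\Sigma_t\mid\Sigma_0]$. Suppose that $F=ERE'$ and $S=EQE'$ with $E$ orthogonal, $R=\mathrm{diag}(\rho_1,\dots,\rho_q)$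 with $|\rho_i|<1$, and $Q=\mathrm{diag}(\xi_1,\dots,\xi_q)$ with $\xi_i>0$. Let $\xi=(\xi_i)$, $\xi_{-1}=(\xi_i^{-1})$, $c_{n,q}=n/(n+q)$, $$\alpha=c_{n,q}(I-R^2)\xi,\qquad B=n^{-1}c_{n,q}(I-R^2)\xi\xi_{-1}'+R^2 .$$ Let $\Sigma_0=E\,\mathrm{diag}(\theta_0)E'$, where $\theta_0$ is a $q$-vector with positive entries. Then, for every $t\ge 0$, the mean $E[\Sigma_t\mid\Sigma_0]$ exists and equals $E\,\mathrm{diag}(\theta_{t|0})E'$ for a $q$-vector $\theta_{t|0}$ (its eigenvalues), with $\theta_{0|0}=\theta_0$, $$\theta_{t|0}=\alpha+B\,\theta_{t-1|0}\quad(t\ge1),\qquad \theta_{t|0}=B^t\theta_0+\sum_{\tau=0}^{t-1}B^\tau\alpha .$$ Moreover $I-B$ is invertible, $\theta_{t|0}=B^t\theta_0+(I-B)^{-1}(I-B^t)\alpha$, and $\lim_{t\to\infty}\theta_{t|0}=\xi$, so that $E[\Sigma_t\mid\Sigma_0]\to S$: the eigenvalues of the limiting conditional mean are those of $S$. -/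

import Mathlib

open MeasureTheory ProbabilityTheory Matrix Filter Topology
open scoped ENNReal

namespace IWAR

/-- Real matrices carry the product (equivalently, Borel) sigma-algebra of their entries. -/
instance instMeasurableSpaceMatrix {m k : Type*} : MeasurableSpace (Matrix m k ℝ) :=
  inferInstanceAs (MeasurableSpace (m → k → ℝ))

theorem measurable_matrix {α m k : Type*} [MeasurableSpace α] {f : α → Matrix m k ℝ}
    (h : ∀ i j, Measurable fun a => f a i j) : Measurable f :=
  measurable_pi_lambda (X := fun _ : m => k → ℝ) f
    fun i => measurable_pi_lambda (X := fun _ : k => ℝ) (fun a => f a i) (h i)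

theorem measurable_entry {m k : Type*} (i : m) (j : k) :
    Measurable fun M : Matrix m k ℝ => M i j :=
  (measurable_pi_apply (X := fun _ : k => ℝ) j).comp
    (measurable_pi_apply (X := fun _ : m => k → ℝ) i)

/-- The symmetric matrix with entries `x_{ij}`, one free coordinate for each unordered pair
`{i, j}` of indices.  Lebesgue measure on these coordinates is the reference measure
`∏_{i ≤ j} dσ_{ij}` of densities on symmetric matrices. -/
def symMat {ι : Type*} (x : Sym2 ι → ℝ) : Matrix ι ι ℝ :=
  Matrix.of fun i j => x s(i, j)

theorem measurable_symMat {ι : Type*} : Measurable (symMat : (Sym2 ι → ℝ) → Matrix ι ι ℝ) :=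
  measurable_matrix fun i j => measurable_pi_apply (s(i, j))

open Classical in
/-- The inverse Wishart density, up to its normalizing constant, with `δ` degrees of freedom and
scale matrix `D`, in the parametrization
`p(M) ∝ |M|^{-(δ + 2p)/2} exp(-tr(D M⁻¹)/2)` on positive definite `p × p` matrices
(so that the mean is `D / (δ - 2)` for `δ > 2`). -/
noncomputable def iwDensity {ι : Type*} [Fintype ι] [DecidableEq ι] (δ : ℝ)
    (D M : Matrix ι ι ℝ) : ℝ≥0∞ :=
  if M.PosDef then
    ENNReal.ofReal (M.det ^ (-(δ + 2 * (Fintype.card ι : ℝ)) / 2) *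
      Real.exp (-(D * M⁻¹).trace / 2))
  else 0

/-- Rescaling of a measure to total mass one. -/
noncomputable def normalize {α : Type*} [MeasurableSpace α] (μ : Measure α) : Measure α :=
  (μ Set.univ)⁻¹ • μ

/-- The inverse Wishart distribution `IW(δ, D)`. -/
noncomputable def inverseWishart {ι : Type*} [Fintype ι] [DecidableEq ι] (δ : ℝ)
    (D : Matrix ι ι ℝ) : Measure (Matrix ι ι ℝ) :=
  (normalize ((volume : Measure (Sym2 ι → ℝ)).withDensity
    fun x => iwDensity δ D (symMat x))).map symMat

/-- The scale matrix `n [[S, S F'], [F S, S]]` of the augmented state. -/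
def augScale {ι : Type*} [Fintype ι] (n : ℝ) (S F : Matrix ι ι ℝ) :
    Matrix (ι ⊕ ι) (ι ⊕ ι) ℝ :=
  n • Matrix.fromBlocks S (S * Fᵀ) (F * S) S

/-- The stationary first-order inverse Wishart autoregression with parameters `n`, `S`, `F`:
a first-order Markov process such that, for every `t`, the pair `(Σ_t, Σ_{t+1})` has the law of
the two diagonal blocks of a `2q × 2q` random matrix with distribution
`IW(n + 2, n [[S, S F'], [F S, S]])`. -/
structure IsIWAR {ι : Type*} [Fintype ι] [DecidableEq ι] {Ω : Type*} [MeasurableSpace Ω]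
    (n : ℝ) (S F : Matrix ι ι ℝ) (P : Measure Ω) (X : ℕ → Ω → Matrix ι ι ℝ) : Prop where
  measurable : ∀ t, Measurable (X t)
  pair_law : ∀ t, P.map (fun ω => (X t ω, X (t + 1) ω)) =
    (inverseWishart (n + 2) (augScale n S F)).map fun M => (M.toBlocks₁₁, M.toBlocks₂₂)
  markov : ∀ (t : ℕ) (A : Set (Matrix ι ι ℝ)), MeasurableSet A →
    P[(X (t + 1) ⁻¹' A).indicator (fun _ => (1 : ℝ)) |
        ⨆ s ∈ Set.Iic t, MeasurableSpace.comap (X s) inferInstance] =ᵐ[P]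
      P[(X (t + 1) ⁻¹' A).indicator (fun _ => (1 : ℝ)) |
        MeasurableSpace.comap (X t) inferInstance]

/-- The joint density of `(Σ_{t-1}, φ_t, Σ_t)` (up to a constant), as a function of
`(φ_t, Σ_t)` for fixed `Σ_{t-1} = A`. -/
noncomputable def sliceDensity {ι : Type*} [Fintype ι] [DecidableEq ι] (n : ℝ)
    (S F A : Matrix ι ι ℝ) (p : (ι → ι → ℝ) × (Sym2 ι → ℝ)) : ℝ≥0∞ :=
  iwDensity (n + 2) (augScale n S F)
    (Matrix.fromBlocks A (Matrix.of p.1)ᵀ (Matrix.of p.1) (symMat p.2))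

/-- The transition law `p(Σ_t | Σ_{t-1} = A)`: the second diagonal block under the conditional
density of `(φ_t, Σ_t)` given `Σ_{t-1} = A`. -/
noncomputable def transitionLaw {ι : Type*} [Fintype ι] [DecidableEq ι] (n : ℝ)
    (S F A : Matrix ι ι ℝ) : Measure (Matrix ι ι ℝ) :=
  (normalize ((volume : Measure ((ι → ι → ℝ) × (Sym2 ι → ℝ))).withDensity
    (sliceDensity n S F A))).map fun p => symMat p.2

theorem measurable_det {ι : Type*} [Fintype ι] [DecidableEq ι] :
    Measurable fun M : Matrix ι ι ℝ => M.det := by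
  simp only [Matrix.det_apply]
  refine Finset.measurable_sum _ fun σ _ => Measurable.const_smul ?_ _
  exact Finset.measurable_prod _ fun i _ => measurable_entry _ _

theorem measurableSet_posDef {ι : Type*} [Fintype ι] [DecidableEq ι] :
    MeasurableSet {M : Matrix ι ι ℝ | M.PosDef} := by
  have h : {M : Matrix ι ι ℝ | M.PosDef} =
      ((⋂ i, ⋂ j, {M : Matrix ι ι ℝ | M j i = M i j}) ∩
        {M | ∀ x : ι → ℝ, 0 ≤ x ⬝ᵥ M *ᵥ x}) ∩ {M | M.det ≠ 0} := by
    ext M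
    have h1 : M.PosDef ↔ M.PosSemidef ∧ M.det ≠ 0 :=
      ⟨fun h => ⟨h.posSemidef, h.det_pos.ne'⟩, fun h => h.1.posDef_iff_det_ne_zero.2 h.2⟩
    simp [h1, Matrix.posSemidef_iff_dotProduct_mulVec, Matrix.IsHermitian, ← Matrix.ext_iff]
  have hcl : IsClosed {M : ι → ι → ℝ | ∀ x : ι → ℝ, 0 ≤ x ⬝ᵥ (Matrix.of M) *ᵥ x} := by
    simp only [Set.ofPred_forall]
    refine isClosed_iInter fun x => isClosed_le continuous_const ?_
    simp only [dotProduct, Matrix.mulVec, Matrix.of_apply]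
    fun_prop
  rw [h]
  refine (MeasurableSet.inter ?_ ?_).inter (measurable_det (measurableSet_singleton 0).compl)
  · exact MeasurableSet.iInter fun i => MeasurableSet.iInter fun j =>
      measurableSet_eq_fun (measurable_entry j i) (measurable_entry i j)
  · exact hcl.measurableSet

theorem measurable_iwDensity {ι : Type*} [Fintype ι] [DecidableEq ι] (δ : ℝ)
    (D : Matrix ι ι ℝ) : Measurable (iwDensity δ D) := by
  classical
  have hinv : ∀ i j, Measurable fun M : Matrix ι ι ℝ => M⁻¹ i j := by
    intro i j
    simp only [Matrix.inv_def, Matrix.smul_apply, smul_eq_mul, Ring.inverse_eq_inv',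
      Matrix.adjugate_apply]
    refine measurable_det.inv.mul (measurable_det.comp (measurable_matrix fun a b => ?_))
    by_cases hab : a = j
    · simp [Matrix.updateRow_apply, hab]
    · simpa [Matrix.updateRow_apply, hab] using measurable_entry a b
  have htr : Measurable fun M : Matrix ι ι ℝ => (D * M⁻¹).trace := by
    simp only [Matrix.trace, Matrix.diag, Matrix.mul_apply]
    exact Finset.measurable_sum _ fun i _ => Finset.measurable_sum _ fun j _ =>
      (hinv j i).const_mul _
  refine Measurable.ite measurableSet_posDef ?_ measurable_const
  exact ((measurable_det.pow_const _).mul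
    (Real.measurable_exp.comp (htr.neg.div_const 2))).ennreal_ofReal

theorem measurable_sliceDensity {ι : Type*} [Fintype ι] [DecidableEq ι] (n : ℝ)
    (S F : Matrix ι ι ℝ) : Measurable
      fun r : Matrix ι ι ℝ × ((ι → ι → ℝ) × (Sym2 ι → ℝ)) => sliceDensity n S F r.1 r.2 := by
  refine (measurable_iwDensity _ _).comp (measurable_matrix fun i j => ?_)
  rcases i with i | i <;> rcases j with j | j <;>
    simp only [Matrix.fromBlocks_apply₁₁, Matrix.fromBlocks_apply₁₂, Matrix.fromBlocks_apply₂₁,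
      Matrix.fromBlocks_apply₂₂, Matrix.transpose_apply, Matrix.of_apply, symMat]
  · exact (measurable_entry i j).comp measurable_fst
  all_goals fun_prop

theorem measurable_transitionLaw {ι : Type*} [Fintype ι] [DecidableEq ι] (n : ℝ)
    (S F : Matrix ι ι ℝ) : Measurable (transitionLaw n S F) := by
  have hm : Measurable fun p : (ι → ι → ℝ) × (Sym2 ι → ℝ) => symMat p.2 :=
    measurable_symMat.comp measurable_snd
  have hs := measurable_sliceDensity n S F
  refine Measure.measurable_of_measurable_coe _ fun B hB => ?_
  have h : ∀ A, transitionLaw n S F A B =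
      (∫⁻ p, sliceDensity n S F A p)⁻¹ *
        ∫⁻ p in (fun p : (ι → ι → ℝ) × (Sym2 ι → ℝ) => symMat p.2) ⁻¹' B,
          sliceDensity n S F A p := by
    intro A
    rw [transitionLaw, Measure.map_apply hm hB, normalize, Measure.smul_apply, smul_eq_mul,
      withDensity_apply _ MeasurableSet.univ, withDensity_apply _ (hm hB), Measure.restrict_univ]
  simp only [h]
  exact hs.lintegral_prod_right'.inv.mul hs.lintegral_prod_right'

/-- The transition kernel of the process. -/
noncomputable def transitionKernel {ι : Type*} [Fintype ι] [DecidableEq ι] (n : ℝ)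
    (S F : Matrix ι ι ℝ) : Kernel (Matrix ι ι ℝ) (Matrix ι ι ℝ) where
  toFun := transitionLaw n S F
  measurable' := measurable_transitionLaw n S F

/-- The law of `Σ_t` for the process started at `Σ_0 = A`. -/
noncomputable def condLaw {ι : Type*} [Fintype ι] [DecidableEq ι] (n : ℝ)
    (S F A : Matrix ι ι ℝ) : ℕ → Measure (Matrix ι ι ℝ)
  | 0 => Measure.dirac A
  | t + 1 => (condLaw n S F A t).bind (transitionKernel n S F)

/-- The conditional mean `E[Σ_t | Σ_0 = A]`. -/
noncomputable def condMean {ι : Type*} [Fintype ι] [DecidableEq ι] (n : ℝ)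
    (S F : Matrix ι ι ℝ) (t : ℕ) (A : Matrix ι ι ℝ) : Matrix ι ι ℝ :=
  Matrix.of fun i j => ∫ M, M i j ∂(condLaw n S F A t)

/-- The constant `c_{n,q} = n / (n + q)`. -/
noncomputable def cnq (n : ℝ) (q : ℕ) : ℝ := n / (n + q)

/-- The vector `α = c_{n,q} (I - R²) ξ`, where `R = diag ρ`. -/
noncomputable def alphaVec {q : ℕ} (n : ℝ) (ρ ξ : Fin q → ℝ) : Fin q → ℝ :=
  cnq n q • ((1 - Matrix.diagonal ρ ^ 2) *ᵥ ξ)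

/-- The matrix `B = n⁻¹ c_{n,q} (I - R²) ξ ξ₋₁' + R²`, where `R = diag ρ` and `ξ₋₁` is the
vector of reciprocals of the entries of `ξ`. -/
noncomputable def bMat {q : ℕ} (n : ℝ) (ρ ξ : Fin q → ℝ) : Matrix (Fin q) (Fin q) ℝ :=
  (n⁻¹ * cnq n q) • ((1 - Matrix.diagonal ρ ^ 2) * Matrix.vecMulVec ξ (fun i => (ξ i)⁻¹)) +
    Matrix.diagonal ρ ^ 2

end IWAR

/-! Write a positive definite block matrix as first block `A`, regression matrix `Y` (so that the
lower left block is `Y * A`) and Schur complement `G`; its second diagonal block is then `G + Y * A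
* Yᵀ`. If the scale matrix is written in the same way with `D`, `F`, `V`, the inverse Wishart
density splits into a factor in `A`, an inverse Wishart density of `G` with scale `V` and degrees of
freedom raised by the size of `A`, and a Gaussian density of `Y` given `G`, centred at `F`
(`iwDensity_blockCongr`). The determinant power left over in `A` cancels the Jacobian of `Y ↦ Y *
A`, so given `A` the law of `(Y, G)` does not involve `A`.

Taking means, `E[G + Y A Y'] = F A F' + (1 + tr(A D⁻¹)) E[G]`. For the augmented scale, `D = n S`
and `V = n (S - F S F')`. The mean `D / (δ - 2)` of an inverse Wishart law is itself obtained from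
this decomposition, by induction on the dimension from the scalar inverse gamma case
(`hasIWMoments`); here it gives `E[G] = n (S - F S F') / (n + q)`. The resulting one-step mean
`meanMap` is affine in `A`, so means propagate by iterating it, both along the chain started at a
point (`condLaw_moments`) and under conditional expectation for any process with the required pair
laws and Markov property (`IsIWAR.condExp_entry`).

In the common eigenbasis `E`, `meanMap` acts on eigenvalues as `θ ↦ α + B θ`
(`meanMap_conj_diagonal`). The vector `ξ` is a fixed point, and `B` is a strict contraction for the
norm `max |x i| / ξ i` (`exists_contraction_bMat`). Hence `B ^ t → 0`, `1 - B` is invertible and the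
iterates converge to `ξ`.

Moments are computed as `ℝ≥0∞`-valued integrals of quadratic forms, where Fubini and substitution
need no integrability; entries are recovered by polarization. -/

set_option linter.unusedSectionVars false

namespace IWAR

/-! ### Schur complement coordinates and factorization of the inverse Wishart density. -/

section BlockAlgebra

variable {ι κ : Type*} [Fintype ι] [DecidableEq ι] [Fintype κ] [DecidableEq κ]

theorem posDef_mul_mul_transpose {T : Matrix ι κ ℝ} {M : Matrix κ κ ℝ} (hM : M.PosDef)
    (hT : Function.Injective T.vecMul) : (T * M * Tᵀ).PosDef := by
  rw [← conjTranspose_eq_transpose_of_trivial]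
  exact hM.mul_mul_conjTranspose_same hT

theorem posDef_conj_iff {T M : Matrix ι ι ℝ} (hT : IsUnit T) :
    (T * M * Tᵀ).PosDef ↔ M.PosDef := by
  constructor
  · intro h
    have h2 := posDef_mul_mul_transpose (T := T⁻¹) h
      (Matrix.vecMul_injective_of_isUnit (Matrix.isUnit_nonsing_inv_iff.2 hT))
    have h1 : IsUnit T.det := (Matrix.isUnit_iff_isUnit_det _).1 hT
    rwa [transpose_nonsing_inv, Matrix.mul_assoc T, Matrix.nonsing_inv_mul_cancel_left _ _ h1,
      Matrix.mul_nonsing_inv_cancel_right _ _ (by rwa [det_transpose])] at h2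
  · intro h
    exact posDef_mul_mul_transpose h (Matrix.vecMul_injective_of_isUnit hT)

theorem posDef_fromBlocks_diag {A : Matrix ι ι ℝ} {G : Matrix κ κ ℝ} :
    (fromBlocks A 0 0 G).PosDef ↔ A.PosDef ∧ G.PosDef := by
  constructor
  · intro h
    exact ⟨h.submatrix Sum.inl_injective, h.submatrix Sum.inr_injective⟩
  · rintro ⟨hA, hG⟩
    refine .of_dotProduct_mulVec_pos ?_ fun x hx => ?_
    · exact IsHermitian.fromBlocks hA.1 (by simp) hG.1
    · rw [← Sum.elim_comp_inl_inr x] at hx ⊢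
      rw [fromBlocks_mulVec]
      simp only [star_trivial, zero_mulVec, add_zero, zero_add, Sum.elim_comp_inl,
        Sum.elim_comp_inr, sumElim_dotProduct_sumElim]
      by_cases h1 : x ∘ Sum.inl = 0
      · have h2 : x ∘ Sum.inr ≠ 0 := by
          rintro h2
          apply hx
          ext (i | i) <;> simp [h1, h2]
        have := hG.dotProduct_mulVec_pos h2
        simp only [star_trivial] at this
        simpa [h1] using this
      · have h3 := hA.dotProduct_mulVec_pos h1
        have h4 := hG.posSemidef.dotProduct_mulVec_nonneg (x ∘ Sum.inr)
        simp only [star_trivial] at h3 h4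
        linarith

/-- The symmetric block matrix with first diagonal block `A`, regression matrix `Y` of the second
block of coordinates on the first, and Schur complement `G`. -/
def blockCongr (A : Matrix ι ι ℝ) (Y : Matrix κ ι ℝ) (G : Matrix κ κ ℝ) :
    Matrix (ι ⊕ κ) (ι ⊕ κ) ℝ :=
  fromBlocks A (A * Yᵀ) (Y * A) (G + Y * A * Yᵀ)

/-- Block `L D Lᵀ` factorization with unipotent `L`: positive definiteness and determinant reduce to
those of `A` and `G`. -/
theorem blockCongr_eq (A : Matrix ι ι ℝ) (Y : Matrix κ ι ℝ) (G : Matrix κ κ ℝ) :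
    blockCongr A Y G =
      fromBlocks 1 0 Y 1 * fromBlocks A 0 0 G * (fromBlocks 1 0 Y 1 : Matrix (ι ⊕ κ) (ι ⊕ κ) ℝ)ᵀ := by
  simp [blockCongr, fromBlocks_multiply, fromBlocks_transpose, Matrix.mul_assoc, add_comm]

theorem trace_fromBlocks' (A : Matrix ι ι ℝ) (B : Matrix ι κ ℝ) (C : Matrix κ ι ℝ)
    (D : Matrix κ κ ℝ) : (fromBlocks A B C D).trace = A.trace + D.trace := by
  simp [Matrix.trace]

theorem det_lower (Y : Matrix κ ι ℝ) :
    (fromBlocks 1 0 Y 1 : Matrix (ι ⊕ κ) (ι ⊕ κ) ℝ).det = 1 := by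
  simp

theorem isUnit_lower (Y : Matrix κ ι ℝ) :
    IsUnit (fromBlocks 1 0 Y 1 : Matrix (ι ⊕ κ) (ι ⊕ κ) ℝ) := by
  rw [Matrix.isUnit_iff_isUnit_det]; simp

theorem posDef_blockCongr {A : Matrix ι ι ℝ} {Y : Matrix κ ι ℝ} {G : Matrix κ κ ℝ} :
    (blockCongr A Y G).PosDef ↔ A.PosDef ∧ G.PosDef := by
  rw [blockCongr_eq, posDef_conj_iff (isUnit_lower Y), posDef_fromBlocks_diag]

theorem det_blockCongr (A : Matrix ι ι ℝ) (Y : Matrix κ ι ℝ) (G : Matrix κ κ ℝ) :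
    (blockCongr A Y G).det = A.det * G.det := by
  rw [blockCongr_eq, det_mul, det_mul, det_transpose, det_lower]
  simp

theorem inv_blockCongr {A : Matrix ι ι ℝ} (Y : Matrix κ ι ℝ) {G : Matrix κ κ ℝ}
    (hA : IsUnit A) (hG : IsUnit G) :
    (blockCongr A Y G)⁻¹ =
      fromBlocks (A⁻¹ + Yᵀ * G⁻¹ * Y) (-(Yᵀ * G⁻¹)) (-(G⁻¹ * Y)) G⁻¹ := by
  have hA' : IsUnit A.det := (Matrix.isUnit_iff_isUnit_det _).1 hA
  have hG' : IsUnit G.det := (Matrix.isUnit_iff_isUnit_det _).1 hG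
  apply Matrix.inv_eq_right_inv
  rw [blockCongr, fromBlocks_multiply, ← fromBlocks_one]
  congr 1
  · simp only [Matrix.mul_add, Matrix.mul_neg, Matrix.mul_nonsing_inv _ hA', Matrix.mul_assoc]
    abel
  · simp only [Matrix.mul_neg, Matrix.mul_assoc]
    abel
  · simp only [Matrix.mul_add, Matrix.add_mul, Matrix.mul_neg, Matrix.mul_assoc,
      Matrix.mul_nonsing_inv _ hA', Matrix.mul_nonsing_inv_cancel_left _ _ hG', Matrix.mul_one]
    abel
  · simp only [Matrix.add_mul, Matrix.mul_neg, Matrix.mul_assoc,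
      Matrix.mul_nonsing_inv _ hG']
    abel

/-- Completing the square in `Y`. With the scale in the same coordinates, its regression matrix `F`
becomes the centre of the quadratic term, and `A`, `G` separate. -/
theorem trace_blockCongr {A D : Matrix ι ι ℝ} (Y F : Matrix κ ι ℝ) {G V : Matrix κ κ ℝ}
    (hA : IsUnit A) (hG : IsUnit G) :
    (blockCongr D F V * (blockCongr A Y G)⁻¹).trace =
      (D * A⁻¹).trace + (V * G⁻¹).trace + (G⁻¹ * ((Y - F) * D * (Y - F)ᵀ)).trace := by
  rw [inv_blockCongr Y hA hG, blockCongr, fromBlocks_multiply, trace_fromBlocks']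
  simp only [Matrix.mul_add, Matrix.add_mul, Matrix.mul_neg, Matrix.mul_sub, Matrix.sub_mul,
    transpose_sub, trace_add, trace_neg, trace_sub]
  have e1 : (D * (Yᵀ * G⁻¹ * Y)).trace = (G⁻¹ * (Y * D * Yᵀ)).trace := by
    rw [← Matrix.mul_assoc, Matrix.trace_mul_comm, ← Matrix.mul_assoc, ← Matrix.mul_assoc,
      Matrix.trace_mul_comm, ← Matrix.mul_assoc]
  have e2 : (D * Fᵀ * (G⁻¹ * Y)).trace = (G⁻¹ * (Y * D * Fᵀ)).trace := by
    rw [Matrix.trace_mul_comm]; simp only [Matrix.mul_assoc]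
  have e3 : (F * D * (Yᵀ * G⁻¹)).trace = (G⁻¹ * (F * D * Yᵀ)).trace := by
    rw [← Matrix.mul_assoc, Matrix.trace_mul_comm]
  have e4 : (F * D * Fᵀ * G⁻¹).trace = (G⁻¹ * (F * D * Fᵀ)).trace := by
    rw [Matrix.trace_mul_comm]
  rw [e1, e2, e3, e4]
  ring

theorem exists_eq_blockCongr {M : Matrix (ι ⊕ κ) (ι ⊕ κ) ℝ} (hM : M.PosDef) :
    ∃ (A : Matrix ι ι ℝ) (Y : Matrix κ ι ℝ) (G : Matrix κ κ ℝ),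
      A.PosDef ∧ G.PosDef ∧ M = blockCongr A Y G := by
  have hA : M.toBlocks₁₁.PosDef := hM.submatrix Sum.inl_injective
  have hA' : IsUnit M.toBlocks₁₁.det := (Matrix.isUnit_iff_isUnit_det _).1 hA.isUnit
  have hs : M.toBlocks₁₁ᵀ = M.toBlocks₁₁ := by
    rw [← conjTranspose_eq_transpose_of_trivial]; exact hA.1
  have h12 : M.toBlocks₂₁ᵀ = M.toBlocks₁₂ := by
    ext i j
    have := hM.1.apply (Sum.inl i) (Sum.inr j)
    simpa [toBlocks₂₁, toBlocks₁₂] using this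
  have hMe : M = blockCongr M.toBlocks₁₁ (M.toBlocks₂₁ * M.toBlocks₁₁⁻¹)
      (M.toBlocks₂₂ - M.toBlocks₂₁ * M.toBlocks₁₁⁻¹ * M.toBlocks₁₂) := by
    conv_lhs => rw [← fromBlocks_toBlocks M]
    rw [blockCongr]
    have h1 : M.toBlocks₂₁ * M.toBlocks₁₁⁻¹ * M.toBlocks₁₁ = M.toBlocks₂₁ :=
      Matrix.nonsing_inv_mul_cancel_right _ _ hA'
    have h2 : M.toBlocks₁₁ * (M.toBlocks₂₁ * M.toBlocks₁₁⁻¹)ᵀ = M.toBlocks₁₂ := by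
      rw [transpose_mul, transpose_nonsing_inv, hs, h12, Matrix.mul_nonsing_inv_cancel_left _ _ hA']
    rw [Matrix.mul_assoc _ _ (_)ᵀ, h2, h1]
    simp
  refine ⟨_, _, _, hA, ?_, hMe⟩
  rw [hMe, posDef_blockCongr] at hM
  exact hM.2

theorem iwDensity_of_posDef {δ : ℝ} {D M : Matrix ι ι ℝ} (hM : M.PosDef) :
    iwDensity δ D M = ENNReal.ofReal (M.det ^ (-(δ + 2 * (Fintype.card ι : ℝ)) / 2) *
      Real.exp (-(D * M⁻¹).trace / 2)) := if_pos hM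

theorem iwDensity_of_not_posDef {δ : ℝ} {D M : Matrix ι ι ℝ} (hM : ¬ M.PosDef) :
    iwDensity δ D M = 0 := if_neg hM

/-- The conditional density, up to a factor depending on `D` only, of the regression matrix given
the Schur complement `G`. -/
noncomputable def regDensity (D : Matrix ι ι ℝ) (F : Matrix κ ι ℝ) (G : Matrix κ κ ℝ)
    (Y : Matrix κ ι ℝ) : ℝ :=
  Real.exp (-(G⁻¹ * ((Y - F) * D * (Y - F)ᵀ)).trace / 2)

/-- The exponents are split with the later integrations in view: `A.det ^ (-card κ)` will cancel the
Jacobian of `Y ↦ Y * A`, and `G.det ^ (-card ι / 2)` the `G`-dependent part of the Gaussian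
normalization of `Y`. -/
theorem iwDensity_blockCongr (δ : ℝ) (D A : Matrix ι ι ℝ) (F Y : Matrix κ ι ℝ)
    (V G : Matrix κ κ ℝ) :
    iwDensity δ (blockCongr D F V) (blockCongr A Y G) =
      ENNReal.ofReal (A.det ^ (-(Fintype.card κ : ℝ))) * iwDensity δ D A *
        (iwDensity (δ + Fintype.card ι) V G *
        (ENNReal.ofReal (G.det ^ (-(Fintype.card ι : ℝ) / 2)) *
          ENNReal.ofReal (regDensity D F G Y))) := by
  by_cases hA : A.PosDef
  · by_cases hG : G.PosDef
    · rw [iwDensity_of_posDef (posDef_blockCongr.2 ⟨hA, hG⟩), iwDensity_of_posDef hA,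
        iwDensity_of_posDef hG, trace_blockCongr Y F hA.isUnit hG.isUnit, det_blockCongr,
        regDensity]
      have ha := hA.det_pos
      have hg := hG.det_pos
      rw [← ENNReal.ofReal_mul (by positivity), ← ENNReal.ofReal_mul (by positivity),
        ← ENNReal.ofReal_mul (by positivity), ← ENNReal.ofReal_mul (by positivity),
        Real.mul_rpow ha.le hg.le, Fintype.card_sum, Nat.cast_add]
      congr 1
      have e1 : A.det ^ (-(δ + 2 * ((Fintype.card ι : ℝ) + Fintype.card κ)) / 2) =
          A.det ^ (-(Fintype.card κ : ℝ)) * A.det ^ (-(δ + 2 * (Fintype.card ι : ℝ)) / 2) := by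
        rw [← Real.rpow_add ha]; congr 1; ring
      have e2 : G.det ^ (-(δ + 2 * ((Fintype.card ι : ℝ) + Fintype.card κ)) / 2) =
          G.det ^ (-(δ + Fintype.card ι + 2 * (Fintype.card κ : ℝ)) / 2) *
            G.det ^ (-(Fintype.card ι : ℝ) / 2) := by
        rw [← Real.rpow_add hg]; congr 1; ring
      have e3 : ∀ x y z : ℝ, Real.exp (-(x + y + z) / 2) =
          Real.exp (-x / 2) * Real.exp (-y / 2) * Real.exp (-z / 2) := by
        intro x y z; rw [← Real.exp_add, ← Real.exp_add]; congr 1; ring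
      rw [e1, e2, e3]
      ring
    · rw [iwDensity_of_not_posDef fun h => hG (posDef_blockCongr.1 h).2,
        iwDensity_of_not_posDef hG]
      simp
  · rw [iwDensity_of_not_posDef fun h => hA (posDef_blockCongr.1 h).1, iwDensity_of_not_posDef hA]
    simp

end BlockAlgebra

end IWAR

namespace IWAR

/-! ### Lebesgue measure on matrices: substitutions and splitting into blocks. -/

section Volume

theorem lintegral_comp_equiv {α β : Type*} [Fintype α] [Fintype β] (e : α ≃ β)
    (f : (α → ℝ) → ℝ≥0∞) : ∫⁻ x : β → ℝ, f (x ∘ e) = ∫⁻ y, f y := by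
  have h := (volume_measurePreserving_piCongrLeft (fun _ : α => ℝ) e.symm).lintegral_comp_emb
    (MeasurableEquiv.measurableEmbedding _) f
  rw [← h]
  congr! with x
  ext i
  simp [MeasurableEquiv.coe_piCongrLeft, Equiv.piCongrLeft_apply]

theorem lintegral_sumElim {α β : Type*} [Fintype α] [Fintype β] {f : (α ⊕ β → ℝ) → ℝ≥0∞}
    (hf : Measurable f) :
    ∫⁻ x, f x = ∫⁻ y : α → ℝ, ∫⁻ z : β → ℝ, f (Sum.elim y z) := by
  rw [← (volume_measurePreserving_sumPiEquivProdPi_symm (fun _ : α ⊕ β => ℝ)).lintegral_comp_emb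
    (MeasurableEquiv.measurableEmbedding _) f, Measure.volume_eq_prod,
    lintegral_prod (fun a => f ((MeasurableEquiv.sumPiEquivProdPi fun _ => ℝ).symm a))
      (hf.comp (MeasurableEquiv.measurable _)).aemeasurable]
  congr! with y z

theorem volume_preserving_uncurry {α β : Type*} [Fintype α] [Fintype β] :
    MeasurePreserving (fun z : α → β → ℝ => fun p : α × β => z p.1 p.2) := by
  refine ⟨by fun_prop, ?_⟩
  symm
  refine Measure.pi_eq fun s hs => ?_
  rw [Measure.map_apply (by fun_prop) (MeasurableSet.univ_pi hs)]
  have : (fun z : α → β → ℝ => fun p : α × β => z p.1 p.2) ⁻¹' (Set.univ.pi s) =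
      Set.univ.pi fun a => Set.univ.pi fun b => s (a, b) := by
    ext z; simp [Set.mem_pi]
  rw [this, volume_pi_pi]
  simp_rw [volume_pi_pi]
  rw [Fintype.prod_prod_type]

theorem lintegral_uncurry {α β : Type*} [Fintype α] [Fintype β] (f : (α × β → ℝ) → ℝ≥0∞) :
    ∫⁻ z : α → β → ℝ, f (fun p => z p.1 p.2) = ∫⁻ y, f y := by
  exact volume_preserving_uncurry.lintegral_comp_emb
    (MeasurableEquiv.curry α β ℝ).symm.measurableEmbedding f

variable {ι κ : Type*} [Fintype ι] [DecidableEq ι] [Fintype κ] [DecidableEq κ]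

/-- The linear map `Z ↦ P Z Q`. -/
def mulMulLin (P : Matrix κ κ ℝ) (Q : Matrix ι ι ℝ) : (κ → ι → ℝ) →ₗ[ℝ] (κ → ι → ℝ) where
  toFun Z := P * Matrix.of Z * Q
  map_add' Z W := by
    change P * (Matrix.of Z + Matrix.of W) * Q = P * Matrix.of Z * Q + P * Matrix.of W * Q
    rw [Matrix.mul_add, Matrix.add_mul]
  map_smul' c Z := by
    change P * (c • Matrix.of Z) * Q = c • (P * Matrix.of Z * Q)
    rw [Matrix.mul_smul, Matrix.smul_mul]

theorem mulMulLin_apply (P : Matrix κ κ ℝ) (Q : Matrix ι ι ℝ) (Z : κ → ι → ℝ) :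
    mulMulLin P Q Z = P * Matrix.of Z * Q := rfl

/-- Right multiplication acts on each of the `card κ` rows separately, by `Qᵀ`. -/
theorem det_mulMulLin_one (Q : Matrix ι ι ℝ) :
    LinearMap.det (mulMulLin (1 : Matrix κ κ ℝ) Q) = Q.det ^ Fintype.card κ := by
  have : mulMulLin (1 : Matrix κ κ ℝ) Q =
      LinearMap.pi fun i => (Matrix.toLin' Qᵀ).comp (LinearMap.proj i) := by
    refine LinearMap.ext fun Z => ?_
    rw [mulMulLin_apply, Matrix.one_mul]
    ext i j
    simp [Matrix.mul_apply, Matrix.mulVec, dotProduct, mul_comm]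
  rw [this, LinearMap.det_pi]
  simp

theorem det_mulMulLin (P : Matrix κ κ ℝ) (Q : Matrix ι ι ℝ) :
    LinearMap.det (mulMulLin P Q) = P.det ^ Fintype.card ι * Q.det ^ Fintype.card κ := by
  -- Transposition conjugates left multiplication by `P` into right multiplication by `Pᵀ`.
  have hl : LinearMap.det (mulMulLin P (1 : Matrix ι ι ℝ)) = P.det ^ Fintype.card ι := by
    have h := LinearMap.det_conj (mulMulLin (1 : Matrix ι ι ℝ) Pᵀ)
      (Matrix.transposeLinearEquiv ι κ ℝ ℝ)
    rw [det_mulMulLin_one] at h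
    rw [← det_transpose P, ← h]
    congr 1
    refine LinearMap.ext fun Z => ?_
    have : P * Matrix.of Z * (1 : Matrix ι ι ℝ) =
        ((1 : Matrix ι ι ℝ) * (Matrix.of Z)ᵀ * Pᵀ)ᵀ := by simp
    exact this
  have : mulMulLin P Q = (mulMulLin P 1).comp (mulMulLin 1 Q) := by
    refine LinearMap.ext fun Z => ?_
    have : P * Matrix.of Z * Q =
        P * ((1 : Matrix κ κ ℝ) * Matrix.of Z * Q) * (1 : Matrix ι ι ℝ) := by
      simp [Matrix.mul_assoc]
    exact this
  rw [this, LinearMap.det_comp, hl, det_mulMulLin_one]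

theorem measurable_of : Measurable (Matrix.of : (κ → ι → ℝ) → Matrix κ ι ℝ) := measurable_id

theorem lintegral_mul_mul {P : Matrix κ κ ℝ} {Q : Matrix ι ι ℝ} (hP : IsUnit P) (hQ : IsUnit Q)
    {f : Matrix κ ι ℝ → ℝ≥0∞} (hf : Measurable f) :
    ∫⁻ Z : κ → ι → ℝ, f (Matrix.of Z) =
      ENNReal.ofReal (|P.det| ^ Fintype.card ι * |Q.det| ^ Fintype.card κ) *
        ∫⁻ Z : κ → ι → ℝ, f (P * Matrix.of Z * Q) := by
  have hP' : P.det ≠ 0 := ((Matrix.isUnit_iff_isUnit_det _).1 hP).ne_zero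
  have hQ' : Q.det ≠ 0 := ((Matrix.isUnit_iff_isUnit_det _).1 hQ).ne_zero
  have hd : LinearMap.det (mulMulLin P Q) ≠ 0 := by
    rw [det_mulMulLin]; positivity
  have h := Measure.map_linearMap_addHaar_eq_smul_addHaar (volume : Measure (κ → ι → ℝ)) hd
  have hm : Measurable (mulMulLin P Q) := (LinearMap.continuous_of_finiteDimensional _).measurable
  have h1 : ∫⁻ Z : κ → ι → ℝ, f (P * Matrix.of Z * Q) =
      ∫⁻ Z, f (Matrix.of Z) ∂(Measure.map (mulMulLin P Q) volume) := by
    exact (lintegral_map (hf.comp measurable_of) hm).symm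
  rw [h1, h, lintegral_smul_measure, det_mulMulLin, smul_eq_mul, ← mul_assoc,
    ← ENNReal.ofReal_mul (by positivity), abs_inv, abs_mul, abs_pow, abs_pow,
    mul_inv_cancel₀ (by positivity)]
  simp

theorem lintegral_add_matrix (F : Matrix κ ι ℝ) (f : Matrix κ ι ℝ → ℝ≥0∞) :
    ∫⁻ Z : κ → ι → ℝ, f (Matrix.of Z + F) = ∫⁻ Z : κ → ι → ℝ, f (Matrix.of Z) :=
  lintegral_add_right_eq_self (μ := (volume : Measure (κ → ι → ℝ))) (fun Z => f (Matrix.of Z)) F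

/-- Symmetry of `N` makes it a vector in the `Sym2` coordinates, where translation invariance
applies. -/
theorem lintegral_symMat_add {N : Matrix κ κ ℝ} (hN : Nᵀ = N) (f : Matrix κ κ ℝ → ℝ≥0∞) :
    ∫⁻ x : Sym2 κ → ℝ, f (symMat x + N) = ∫⁻ x : Sym2 κ → ℝ, f (symMat x) := by
  let y : Sym2 κ → ℝ := Sym2.lift ⟨fun i j => N i j, fun i j => by
    conv_lhs => rw [← hN]
    rfl⟩
  have hy : ∀ x, symMat x + N = symMat (x + y) := by
    intro x; ext i j; simp [symMat, y]
  simp_rw [hy]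
  exact lintegral_add_right_eq_self (μ := (volume : Measure (Sym2 κ → ℝ))) (fun x => f (symMat x)) y

theorem lintegral_symMat_submatrix (e : ι ≃ κ) (f : Matrix ι ι ℝ → ℝ≥0∞) :
    ∫⁻ x : Sym2 κ → ℝ, f ((symMat x).submatrix e e) = ∫⁻ x : Sym2 ι → ℝ, f (symMat x) := by
  let g : Sym2 ι ≃ Sym2 κ :=
    ⟨Sym2.map e, Sym2.map e.symm, fun z => by simp [Sym2.map_map],
      fun z => by simp [Sym2.map_map]⟩
  exact lintegral_comp_equiv g fun y => f (symMat y)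

/-- Unordered pairs of elements of a disjoint union. -/
noncomputable def sym2Sum (ι κ : Type*) : Sym2 ι ⊕ ((κ × ι) ⊕ Sym2 κ) ≃ Sym2 (ι ⊕ κ) :=
  Equiv.ofBijective (Sum.elim (Sym2.map Sum.inl)
    (Sum.elim (fun p => s(Sum.inr p.1, Sum.inl p.2)) (Sym2.map Sum.inr))) <| by
    constructor
    · rintro (a | ⟨a1, a2⟩ | a) (b | ⟨b1, b2⟩ | b) <;> try induction a using Sym2.ind
      all_goals try induction b using Sym2.ind
      all_goals simp
    · intro z
      induction z using Sym2.ind with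
      | _ x y =>
        rcases x with x | x <;> rcases y with y | y
        · exact ⟨Sum.inl s(x, y), rfl⟩
        · exact ⟨Sum.inr (Sum.inl (y, x)), Sym2.eq_swap⟩
        · exact ⟨Sum.inr (Sum.inl (x, y)), rfl⟩
        · exact ⟨Sum.inr (Sum.inr s(x, y)), rfl⟩

theorem measurable_fromBlocks {α : Type*} [MeasurableSpace α] {A : α → Matrix ι ι ℝ}
    {B : α → Matrix ι κ ℝ} {C : α → Matrix κ ι ℝ} {D : α → Matrix κ κ ℝ} (hA : Measurable A)
    (hB : Measurable B) (hC : Measurable C) (hD : Measurable D) :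
    Measurable fun a => fromBlocks (A a) (B a) (C a) (D a) := by
  refine measurable_matrix fun i j => ?_
  rcases i with i | i <;> rcases j with j | j
  · exact (measurable_entry i j).comp hA
  · exact (measurable_entry i j).comp hB
  · exact (measurable_entry i j).comp hC
  · exact (measurable_entry i j).comp hD

theorem measurable_transpose' : Measurable (Matrix.transpose : Matrix κ ι ℝ → Matrix ι κ ℝ) :=
  measurable_matrix fun i j => measurable_entry j i

theorem measurable_mul' {α μ : Type*} [MeasurableSpace α] {A : α → Matrix κ ι ℝ}
    {B : α → Matrix ι μ ℝ} (hA : Measurable A) (hB : Measurable B) :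
    Measurable fun a => A a * B a := by
  refine measurable_matrix fun i j => ?_
  simp only [Matrix.mul_apply]
  exact Finset.measurable_sum _ fun k _ =>
    ((measurable_entry i k).comp hA).mul ((measurable_entry k j).comp hB)

theorem measurable_add' {α : Type*} [MeasurableSpace α] {A B : α → Matrix κ ι ℝ}
    (hA : Measurable A) (hB : Measurable B) : Measurable fun a => A a + B a :=
  measurable_matrix fun i j => ((measurable_entry i j).comp hA).add ((measurable_entry i j).comp hB)

/-- Unordered pairs from `ι ⊕ κ` lie inside `ι`, across, or inside `κ`; the pairs across are the
free entries of the lower left block. -/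
theorem lintegral_symMat_sum {f : Matrix (ι ⊕ κ) (ι ⊕ κ) ℝ → ℝ≥0∞} (hf : Measurable f) :
    ∫⁻ x : Sym2 (ι ⊕ κ) → ℝ, f (symMat x) =
      ∫⁻ x : Sym2 ι → ℝ, ∫⁻ p : (κ → ι → ℝ) × (Sym2 κ → ℝ),
        f (fromBlocks (symMat x) (Matrix.of p.1)ᵀ (Matrix.of p.1) (symMat p.2)) := by
  have h0 : ∀ x : Sym2 (ι ⊕ κ) → ℝ, x = (x ∘ sym2Sum ι κ) ∘ (sym2Sum ι κ).symm := by
    intro x; ext; simp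
  have h1 : ∫⁻ x : Sym2 (ι ⊕ κ) → ℝ, f (symMat x) =
      ∫⁻ x : (Sym2 ι ⊕ ((κ × ι) ⊕ Sym2 κ)) → ℝ, f (symMat (x ∘ (sym2Sum ι κ).symm)) := by
    rw [← lintegral_comp_equiv (sym2Sum ι κ)]
    congr! with x
    exact h0 x
  have hs : Measurable fun x : (Sym2 ι ⊕ ((κ × ι) ⊕ Sym2 κ)) → ℝ =>
      f (symMat (x ∘ (sym2Sum ι κ).symm)) :=
    hf.comp (measurable_symMat.comp (measurable_pi_lambda _ fun _ => measurable_pi_apply _))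
  rw [h1, lintegral_sumElim hs]
  refine lintegral_congr fun x => ?_
  have hs2 : Measurable fun z : ((κ × ι) ⊕ Sym2 κ) → ℝ =>
      f (symMat (Sum.elim x z ∘ (sym2Sum ι κ).symm)) := by
    refine hs.comp (measurable_pi_lambda _ ?_)
    rintro (i | i)
    · exact measurable_const
    · exact measurable_pi_apply _
  rw [lintegral_sumElim hs2, ← lintegral_uncurry, Measure.volume_eq_prod, lintegral_prod]
  · refine lintegral_congr fun Z => lintegral_congr fun y => ?_
    congr 1
    ext i j
    have e1 : ∀ i j, (sym2Sum ι κ).symm s(Sum.inl i, Sum.inl j) = Sum.inl s(i, j) := by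
      intro i j; rw [Equiv.symm_apply_eq]; rfl
    have e2 : ∀ i j, (sym2Sum ι κ).symm s(Sum.inr i, Sum.inl j) = Sum.inr (Sum.inl (i, j)) := by
      intro i j; rw [Equiv.symm_apply_eq]; rfl
    have e3 : ∀ i j, (sym2Sum ι κ).symm s(Sum.inl i, Sum.inr j) = Sum.inr (Sum.inl (j, i)) := by
      intro i j; rw [Equiv.symm_apply_eq]; exact Sym2.eq_swap
    have e4 : ∀ i j, (sym2Sum ι κ).symm s(Sum.inr i, Sum.inr j) = Sum.inr (Sum.inr s(i, j)) := by
      intro i j; rw [Equiv.symm_apply_eq]; rfl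
    rcases i with i | i <;> rcases j with j | j <;> simp [symMat, e1, e2, e3, e4]
  · exact (hf.comp (measurable_fromBlocks measurable_const
      (measurable_transpose'.comp (measurable_of.comp measurable_fst))
      (measurable_of.comp measurable_fst) (measurable_symMat.comp measurable_snd))).aemeasurable

end Volume

end IWAR

namespace IWAR

/-! ### Second moments of Gaussian vectors and of the Gaussian regression matrix. -/

section Gaussian

theorem pi_gaussianReal_eq_withDensity (τ : Type*) [Fintype τ] :
    Measure.pi (fun _ : τ => gaussianReal 0 1) =
      (volume : Measure (τ → ℝ)).withDensity
        fun x => ENNReal.ofReal (∏ i, gaussianPDFReal 0 1 (x i)) := by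
  refine Measure.pi_eq fun s hs => ?_
  rw [withDensity_apply _ (MeasurableSet.univ_pi hs), volume_pi, Measure.restrict_pi_pi,
    ← ofReal_integral_eq_lintegral_ofReal]
  · rw [integral_fintype_prod_eq_prod (fun _ => gaussianPDFReal 0 1),
      ENNReal.ofReal_prod_of_nonneg fun i _ =>
        integral_nonneg fun x => gaussianPDFReal_nonneg 0 1 x]
    refine Finset.prod_congr rfl fun i _ => ?_
    rw [gaussianReal_apply_eq_integral _ one_ne_zero]
  · exact Integrable.fintype_prod fun i => (integrable_gaussianPDFReal 0 1).restrict
  · exact ae_of_all _ fun x => Finset.prod_nonneg fun i _ => gaussianPDFReal_nonneg 0 1 _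

/-- `K` is `(2π) ^ (card τ / 2)`. Its value is hidden because such constants cancel on
normalization. -/
theorem exists_lintegral_exp_eq (τ : Type*) [Fintype τ] :
    ∃ K : ℝ≥0∞, K ≠ 0 ∧ K ≠ ⊤ ∧ ∀ g : (τ → ℝ) → ℝ≥0∞, Measurable g →
      ∫⁻ x : τ → ℝ, ENNReal.ofReal (Real.exp (-(∑ i, x i ^ 2) / 2)) * g x =
        K * ∫⁻ x, g x ∂(Measure.pi fun _ : τ => gaussianReal 0 1) := by
  have hC : 0 < ((√(2 * Real.pi))⁻¹) ^ Fintype.card τ := by positivity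
  refine ⟨(ENNReal.ofReal (((√(2 * Real.pi))⁻¹) ^ Fintype.card τ))⁻¹, ?_, ?_, fun g hg => ?_⟩
  · exact ENNReal.inv_ne_zero.2 ENNReal.ofReal_ne_top
  · exact ENNReal.inv_ne_top.2 (ENNReal.ofReal_pos.2 hC).ne'
  · rw [pi_gaussianReal_eq_withDensity, lintegral_withDensity_eq_lintegral_mul _ _ hg,
      ← lintegral_const_mul]
    · refine lintegral_congr fun x => ?_
      have : ∏ i, gaussianPDFReal 0 1 (x i) = ((√(2 * Real.pi))⁻¹) ^ Fintype.card τ *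
          Real.exp (-(∑ i, x i ^ 2) / 2) := by
        simp [gaussianPDFReal, Finset.prod_mul_distrib, ← Real.exp_sum, Finset.sum_div,
          neg_div]
      rw [Pi.mul_apply, this, ENNReal.ofReal_mul hC.le, ← mul_assoc, ← mul_assoc,
        ENNReal.inv_mul_cancel (ENNReal.ofReal_pos.2 hC).ne' ENNReal.ofReal_ne_top, one_mul]
    · refine Measurable.mul (Measurable.ennreal_ofReal ?_) hg
      exact Finset.measurable_prod _ fun i _ =>
        (measurable_gaussianPDFReal 0 1).comp (measurable_pi_apply i)
    · refine Measurable.ennreal_ofReal ?_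
      exact Finset.measurable_prod _ fun i _ =>
        (measurable_gaussianPDFReal 0 1).comp (measurable_pi_apply i)

/-- The linear part has mean zero, which kills the cross term, and variance `∑ c i ^ 2` by
independence. -/
theorem lintegral_sq_affine_pi_gaussianReal {τ : Type*} [Fintype τ] (a : ℝ) (c : τ → ℝ) :
    ∫⁻ x, ENNReal.ofReal ((a + ∑ i, c i * x i) ^ 2)
      ∂(Measure.pi fun _ : τ => gaussianReal 0 1) = ENNReal.ofReal (a ^ 2 + ∑ i, c i ^ 2) := by
  set μ := Measure.pi fun _ : τ => gaussianReal 0 1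
  have h1 : ∀ i, MemLp (fun x : ℝ => c i * x) 2 (gaussianReal 0 1) := fun i =>
    (memLp_id_gaussianReal 2).const_mul (c i)
  have h2 : ∀ i, MemLp (fun x : τ → ℝ => c i * x i) 2 μ := fun i =>
    (h1 i).comp_measurePreserving (measurePreserving_eval _ i)
  have hL : MemLp (fun x : τ → ℝ => ∑ i, c i * x i) 2 μ :=
    memLp_finsetSum _ fun i _ => h2 i
  have hm : ∫ x, ∑ i, c i * x i ∂μ = 0 := by
    rw [integral_finsetSum _ fun i _ => (h2 i).integrable one_le_two]
    refine Finset.sum_eq_zero fun i _ => ?_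
    have : ∫ x : τ → ℝ, c i * x i ∂μ = ∫ y, c i * y ∂(gaussianReal 0 1) := by
      rw [← (measurePreserving_eval (fun _ : τ => gaussianReal 0 1) i).map_eq, integral_map]
      · exact (measurable_pi_apply i).aemeasurable
      · exact (measurable_const_mul (c i)).aestronglyMeasurable
    rw [this, integral_const_mul, integral_id_gaussianReal, mul_zero]
  have hv : ∫ x, (∑ i, c i * x i) ^ 2 ∂μ = ∑ i, c i ^ 2 := by
    have h := variance_sum_pi h1
    rw [variance_eq_integral] at h
    · simp only [Finset.sum_apply] at h
      rw [hm] at h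
      simp only [sub_zero] at h
      rw [h]
      refine Finset.sum_congr rfl fun i _ => ?_
      rw [variance_const_mul]
      have : Var[fun x => x; gaussianReal 0 1] = 1 := variance_id_gaussianReal (μ := 0) (v := 1)
      rw [this, mul_one]
    · exact (Finset.aemeasurable_sum _ fun i _ => (h2 i).aemeasurable)
  have hi : Integrable (fun x : τ → ℝ => (a + ∑ i, c i * x i) ^ 2) μ :=
    ((memLp_const a).add hL).integrable_sq
  rw [← ofReal_integral_eq_lintegral_ofReal hi (ae_of_all _ fun x => sq_nonneg _)]
  congr 1
  have : ∀ x : τ → ℝ, (a + ∑ i, c i * x i) ^ 2 =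
      a ^ 2 + (2 * a * (∑ i, c i * x i) + (∑ i, c i * x i) ^ 2) := fun x => by ring
  simp_rw [this]
  have hLi : Integrable (fun x : τ → ℝ => 2 * a * (∑ i, c i * x i)) μ :=
    (hL.integrable one_le_two).const_mul _
  have hLs : Integrable (fun x : τ → ℝ => 2 * a * (∑ i, c i * x i) + (∑ i, c i * x i) ^ 2) μ :=
    hLi.add hL.integrable_sq
  rw [integral_add (integrable_const _) hLs,
    integral_add hLi hL.integrable_sq, integral_const_mul, hm, hv]
  simp [μ]

open scoped MatrixOrder in
theorem exists_eq_transpose_mul_self {ι : Type*} [Fintype ι] [DecidableEq ι] {A : Matrix ι ι ℝ}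
    (hA : A.PosDef) : ∃ B : Matrix ι ι ℝ, IsUnit B ∧ A = Bᵀ * B := by
  obtain ⟨y, hy, h⟩ := CStarAlgebra.isStrictlyPositive_iff_eq_star_mul_self.mp
        hA.isStrictlyPositive
  exact ⟨y, hy, by rw [h, star_eq_conjTranspose, conjTranspose_eq_transpose_of_trivial]⟩

variable {ι κ : Type*} [Fintype ι] [DecidableEq ι] [Fintype κ] [DecidableEq κ]

theorem measurable_trace' {α : Type*} [MeasurableSpace α] {f : α → Matrix ι ι ℝ}
    (hf : Measurable f) : Measurable fun a => (f a).trace :=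
  Finset.measurable_sum _ fun i _ => (measurable_entry i i).comp hf

theorem lintegral_matrix_gaussian (κ ι : Type*) [Fintype κ] [Fintype ι] :
    ∃ K : ℝ≥0∞, K ≠ 0 ∧ K ≠ ⊤ ∧
      ∫⁻ Z : κ → ι → ℝ, ENNReal.ofReal
        (Real.exp (-(Matrix.of Z * (Matrix.of Z)ᵀ).trace / 2)) = K ∧
      ∀ (a : ℝ) (c : Matrix κ ι ℝ),
        ∫⁻ Z : κ → ι → ℝ, ENNReal.ofReal
          (Real.exp (-(Matrix.of Z * (Matrix.of Z)ᵀ).trace / 2)) *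
          ENNReal.ofReal ((a + ∑ k, ∑ i, c k i * Z k i) ^ 2) =
        K * ENNReal.ofReal (a ^ 2 + ∑ k, ∑ i, c k i ^ 2) := by
  obtain ⟨K, h0, h1, hK⟩ := exists_lintegral_exp_eq (κ × ι)
  have hw : ∀ Z : κ → ι → ℝ, (Matrix.of Z * (Matrix.of Z)ᵀ).trace =
      ∑ p : κ × ι, Z p.1 p.2 ^ 2 := by
    intro Z
    simp [Matrix.trace, Matrix.mul_apply, Fintype.sum_prod_type, sq]
  refine ⟨K, h0, h1, ?_, fun a c => ?_⟩
  · have h := hK (fun _ => 1) measurable_const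
    simp only [mul_one, lintegral_const, measure_univ] at h
    rw [← h, ← lintegral_uncurry]
    simp_rw [hw]
  · have h := hK (fun x => ENNReal.ofReal ((a + ∑ p : κ × ι, c p.1 p.2 * x p) ^ 2))
      (by fun_prop)
    rw [lintegral_sq_affine_pi_gaussianReal, ← lintegral_uncurry] at h
    simp only [Fintype.sum_prod_type] at h hw
    simp_rw [hw, h]

/-- With `G = Cᵀ C` and `Q D Qᵀ = 1`, the substitution `Y = Cᵀ Z Q + F` turns the density into that
of a standard Gaussian `Z`, with Jacobian `G.det ^ (card ι / 2)` times a constant depending on `D`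
only. The order of quantifiers matters: `K` serves all `F`, `G` and `A`. -/
theorem exists_lintegral_regDensity {D : Matrix ι ι ℝ} (hD : D.PosDef) (κ : Type*) [Fintype κ]
    [DecidableEq κ] :
    ∃ K : ℝ≥0∞, K ≠ 0 ∧ K ≠ ⊤ ∧ ∀ (F : Matrix κ ι ℝ) (G : Matrix κ κ ℝ), G.PosDef →
      ∫⁻ Y : κ → ι → ℝ, ENNReal.ofReal (regDensity D F G (Matrix.of Y)) =
        ENNReal.ofReal (G.det ^ ((Fintype.card ι : ℝ) / 2)) * K ∧
      ∀ (A : Matrix ι ι ℝ) (v : ι → ℝ) (w : κ → ℝ), A.PosDef →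
        ∫⁻ Y : κ → ι → ℝ, ENNReal.ofReal (regDensity D F G (Matrix.of Y)) *
          ENNReal.ofReal ((v + (Matrix.of Y)ᵀ *ᵥ w) ⬝ᵥ A *ᵥ (v + (Matrix.of Y)ᵀ *ᵥ w)) =
        ENNReal.ofReal (G.det ^ ((Fintype.card ι : ℝ) / 2)) * K *
          ENNReal.ofReal ((v + Fᵀ *ᵥ w) ⬝ᵥ A *ᵥ (v + Fᵀ *ᵥ w) +
            (A * D⁻¹).trace * (w ⬝ᵥ G *ᵥ w)) := by
  obtain ⟨B, hB, hDB⟩ := exists_eq_transpose_mul_self hD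
  obtain ⟨K, h0, h1, hK, hK2⟩ := lintegral_matrix_gaussian κ ι
  have hBd : IsUnit B.det := (Matrix.isUnit_iff_isUnit_det _).1 hB
  have hBtd : IsUnit Bᵀ.det := by rwa [det_transpose]
  obtain ⟨Q, hQ, hQDQ, hQQ⟩ : ∃ Q : Matrix ι ι ℝ, IsUnit Q ∧ Q * D * Qᵀ = 1 ∧ Qᵀ * Q = D⁻¹ := by
    refine ⟨B⁻¹ᵀ, ?_, ?_, ?_⟩
    · rw [Matrix.isUnit_transpose, Matrix.isUnit_nonsing_inv_iff]; exact hB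
    · rw [hDB, transpose_transpose, transpose_nonsing_inv,
        Matrix.nonsing_inv_mul_cancel_left _ _ hBtd, Matrix.mul_nonsing_inv _ hBd]
    · rw [hDB, transpose_transpose, transpose_nonsing_inv, Matrix.mul_inv_rev]
  have hQd : Q.det ≠ 0 := ((Matrix.isUnit_iff_isUnit_det _).1 hQ).ne_zero
  refine ⟨ENNReal.ofReal (|Q.det| ^ Fintype.card κ) * K, ?_, ?_, fun F G hG => ?_⟩
  · refine mul_ne_zero ?_ h0
    simp only [ne_eq, ENNReal.ofReal_eq_zero, not_le]
    positivity
  · exact ENNReal.mul_ne_top ENNReal.ofReal_ne_top h1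
  obtain ⟨C, hC, hGC⟩ := exists_eq_transpose_mul_self hG
  have hCd : IsUnit C.det := (Matrix.isUnit_iff_isUnit_det _).1 hC
  have hCtd : IsUnit Cᵀ.det := by rwa [det_transpose]
  have hPdet : |Cᵀ.det| ^ Fintype.card ι = G.det ^ ((Fintype.card ι : ℝ) / 2) := by
    have : G.det = |Cᵀ.det| ^ 2 := by rw [hGC, det_mul, det_transpose, sq_abs, sq]
    rw [this, ← Real.rpow_natCast, ← Real.rpow_natCast, ← Real.rpow_mul (abs_nonneg _)]
    congr 1; push_cast; ring
  have key : ∀ g : Matrix κ ι ℝ → ℝ≥0∞, Measurable g →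
      ∫⁻ Y : κ → ι → ℝ, ENNReal.ofReal (regDensity D F G (Matrix.of Y)) * g (Matrix.of Y) =
        ENNReal.ofReal (G.det ^ ((Fintype.card ι : ℝ) / 2)) *
          ENNReal.ofReal (|Q.det| ^ Fintype.card κ) *
        ∫⁻ Z : κ → ι → ℝ, ENNReal.ofReal
          (Real.exp (-(Matrix.of Z * (Matrix.of Z)ᵀ).trace / 2)) *
          g (Cᵀ * Matrix.of Z * Q + F) := by
    intro g hg
    rw [← lintegral_add_matrix F fun Y => ENNReal.ofReal (regDensity D F G Y) * g Y,
      lintegral_mul_mul (P := Cᵀ) (Q := Q) (by rwa [Matrix.isUnit_transpose]) hQ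
        (f := fun Y => ENNReal.ofReal (regDensity D F G (Y + F)) * g (Y + F)), hPdet,
      ENNReal.ofReal_mul (by have := hG.det_pos; positivity)]
    · congr! 3 with Z
      have : (Cᵀ * Matrix.of Z * Q) * D * (Cᵀ * Matrix.of Z * Q)ᵀ =
          Cᵀ * (Matrix.of Z * (Matrix.of Z)ᵀ) * C := by
        rw [transpose_mul, transpose_mul, transpose_transpose]
        calc _ = Cᵀ * Matrix.of Z * (Q * D * Qᵀ) * ((Matrix.of Z)ᵀ * C) := by
              simp only [Matrix.mul_assoc]
          _ = _ := by rw [hQDQ]; simp only [Matrix.mul_assoc, Matrix.mul_one]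
      rw [regDensity, add_sub_cancel_right, this, hGC, Matrix.mul_inv_rev, ← Matrix.mul_assoc,
        ← Matrix.mul_assoc, Matrix.nonsing_inv_mul_cancel_right _ _ hCtd, Matrix.mul_assoc,
        Matrix.trace_mul_comm, Matrix.mul_nonsing_inv_cancel_right _ _ hCd]
    · have hm : Measurable fun Y : Matrix κ ι ℝ => Y + F := measurable_add' measurable_id measurable_const
      refine Measurable.mul (Measurable.ennreal_ofReal ?_) (hg.comp hm)
      unfold regDensity
      simp only [add_sub_cancel_right]
      refine Real.measurable_exp.comp (Measurable.div_const (Measurable.neg ?_) _)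
      exact measurable_trace' (measurable_mul' measurable_const
        (measurable_mul' (measurable_mul' measurable_id measurable_const) measurable_transpose'))
  constructor
  · have h := key (fun _ => 1) measurable_const
    simp only [mul_one, hK] at h
    rw [h, mul_assoc]
  · intro A v w hA
    obtain ⟨T, hT, hAT⟩ := exists_eq_transpose_mul_self hA
    rw [key fun Y => ENNReal.ofReal ((v + Yᵀ *ᵥ w) ⬝ᵥ A *ᵥ (v + Yᵀ *ᵥ w))]
    · set u := v + Fᵀ *ᵥ w with hu
      -- Since `A = Tᵀ T`, the form is a squared Euclidean norm, and each coordinate is affine in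
      -- the entries of `Z`. The squared coefficients will sum to `tr(A D⁻¹) (w ⬝ᵥ G *ᵥ w)`.
      have hq : ∀ Z : κ → ι → ℝ, ENNReal.ofReal ((v + (Cᵀ * Matrix.of Z * Q + F)ᵀ *ᵥ w) ⬝ᵥ
          A *ᵥ (v + (Cᵀ * Matrix.of Z * Q + F)ᵀ *ᵥ w)) =
          ∑ l, ENNReal.ofReal (((T *ᵥ u) l +
            ∑ k, ∑ i, (Matrix.of fun k i => (T * Qᵀ) l i * (C *ᵥ w) k) k i * Z k i) ^ 2) := by
        intro Z
        rw [← ENNReal.ofReal_sum_of_nonneg fun _ _ => sq_nonneg _]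
        congr 1
        have e1 : v + (Cᵀ * Matrix.of Z * Q + F)ᵀ *ᵥ w = u + Qᵀ *ᵥ ((Matrix.of Z)ᵀ *ᵥ (C *ᵥ w)) := by
          rw [hu, transpose_add, Matrix.add_mulVec, transpose_mul, transpose_mul,
            transpose_transpose, Matrix.mulVec_mulVec, Matrix.mulVec_mulVec, Matrix.mul_assoc]
          abel
        rw [e1, hAT, ← Matrix.mulVec_mulVec, Matrix.dotProduct_mulVec, Matrix.vecMul_transpose,
          dotProduct]
        refine Finset.sum_congr rfl fun l _ => ?_
        rw [← sq, Matrix.mulVec_add, Pi.add_apply, Matrix.mulVec_mulVec]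
        congr 2
        generalize C *ᵥ w = y
        simp only [Matrix.mulVec, dotProduct, Matrix.transpose_apply, Matrix.of_apply,
          Finset.mul_sum]
        rw [Finset.sum_comm]
        refine Finset.sum_congr rfl fun _ _ => Finset.sum_congr rfl fun _ _ => ?_
        ring
      simp_rw [hq, Finset.mul_sum]
      rw [lintegral_finsetSum]
      · simp_rw [hK2]
        rw [← Finset.mul_sum, ← ENNReal.ofReal_sum_of_nonneg fun _ _ => by positivity,
          ← mul_assoc, ← mul_assoc]
        congr 2
        rw [Finset.sum_add_distrib]
        congr 1
        · rw [hAT, ← Matrix.mulVec_mulVec, Matrix.dotProduct_mulVec, Matrix.vecMul_transpose,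
            dotProduct]
          simp only [sq]
        · have e2 : w ⬝ᵥ G *ᵥ w = ∑ k, (C *ᵥ w) k ^ 2 := by
            rw [hGC, ← Matrix.mulVec_mulVec, Matrix.dotProduct_mulVec, Matrix.vecMul_transpose,
              dotProduct]
            simp only [sq]
          have e3 : (A * D⁻¹).trace = ∑ l, ∑ i, (T * Qᵀ) l i ^ 2 := by
            rw [← hQQ, hAT, Matrix.mul_assoc, Matrix.trace_mul_comm]
            have : T * (Qᵀ * Q) * Tᵀ = (T * Qᵀ) * (T * Qᵀ)ᵀ := by
              simp [Matrix.mul_assoc, transpose_mul]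
            rw [this]
            generalize T * Qᵀ = H
            simp [Matrix.trace, Matrix.mul_apply, sq]
          rw [e2, e3, Finset.sum_mul]
          refine Finset.sum_congr rfl fun l _ => ?_
          rw [Finset.sum_mul_sum, Finset.sum_comm]
          simp only [Matrix.of_apply, mul_pow]
      · intro l _
        refine Measurable.mul ?_ (Measurable.ennreal_ofReal (by fun_prop))
        refine Measurable.ennreal_ofReal (Real.measurable_exp.comp ?_)
        exact (measurable_trace' (measurable_mul' measurable_of
          (measurable_transpose'.comp measurable_of))).neg.div_const _
    · refine Measurable.ennreal_ofReal ?_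
      have hY : ∀ i, Measurable fun Y : Matrix κ ι ℝ => v i + ∑ k, Y k i * w k := fun i =>
        (Finset.measurable_sum _ fun k _ => (measurable_entry k i).mul_const _).const_add _
      simp only [dotProduct, Matrix.mulVec, Pi.add_apply, Matrix.transpose_apply]
      exact Finset.measurable_sum _ fun i _ =>
        (hY i).mul (Finset.measurable_sum _ fun j _ => (hY j).const_mul _)

end Gaussian

end IWAR

namespace IWAR

/-! ### Integrals of the density over the remaining blocks when the first block is fixed. -/

section Slice

variable {ι κ : Type*} [Fintype ι] [DecidableEq ι] [Fintype κ] [DecidableEq κ]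

theorem iwDensity_ne_top (δ : ℝ) (D M : Matrix ι ι ℝ) : iwDensity δ D M ≠ ⊤ := by
  by_cases hM : M.PosDef
  · rw [iwDensity_of_posDef hM]; exact ENNReal.ofReal_ne_top
  · rw [iwDensity_of_not_posDef hM]; exact ENNReal.zero_ne_top

theorem transpose_eq_of_posDef {M : Matrix ι ι ℝ} (hM : M.PosDef) : Mᵀ = M := by
  rw [← conjTranspose_eq_transpose_of_trivial]; exact hM.1

theorem blockCongr_quadForm (D : Matrix ι ι ℝ) (F : Matrix κ ι ℝ)
    (V : Matrix κ κ ℝ) (v : ι → ℝ) (w : κ → ℝ) :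
    Sum.elim v w ⬝ᵥ blockCongr D F V *ᵥ Sum.elim v w =
      (v + Fᵀ *ᵥ w) ⬝ᵥ D *ᵥ (v + Fᵀ *ᵥ w) + w ⬝ᵥ V *ᵥ w := by
  have h1 : ∀ x : κ → ℝ, ∀ y : ι → ℝ, x ⬝ᵥ F *ᵥ y = (Fᵀ *ᵥ x) ⬝ᵥ y := by
    intro x y; rw [Matrix.dotProduct_mulVec, Matrix.mulVec_transpose]
  rw [blockCongr, fromBlocks_mulVec]
  simp only [Sum.elim_comp_inl, Sum.elim_comp_inr, sumElim_dotProduct_sumElim, Matrix.add_mulVec,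
    ← Matrix.mulVec_mulVec, Matrix.mulVec_add, dotProduct_add, add_dotProduct, h1]
  ring

/-- Two substitutions lead to Schur complement coordinates: `φ = Y * A`, with Jacobian `A.det ^ card
κ`, then a translation of the last block by `Y * A * Yᵀ`. When `A` is not positive definite both
sides vanish. -/
theorem lintegral_iwDensity_slice (δ : ℝ) (D : Matrix ι ι ℝ) (F : Matrix κ ι ℝ)
    (V : Matrix κ κ ℝ) (A : Matrix ι ι ℝ) {g : Matrix (ι ⊕ κ) (ι ⊕ κ) ℝ → ℝ≥0∞}
    (hg : Measurable g) :
    ∫⁻ p : (κ → ι → ℝ) × (Sym2 κ → ℝ), iwDensity δ (blockCongr D F V)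
        (fromBlocks A (Matrix.of p.1)ᵀ (Matrix.of p.1) (symMat p.2)) *
        g (fromBlocks A (Matrix.of p.1)ᵀ (Matrix.of p.1) (symMat p.2)) =
      iwDensity δ D A * ∫⁻ y : Sym2 κ → ℝ, iwDensity (δ + Fintype.card ι) V (symMat y) *
        (ENNReal.ofReal ((symMat y).det ^ (-(Fintype.card ι : ℝ) / 2)) *
          ∫⁻ Y : κ → ι → ℝ, ENNReal.ofReal (regDensity D F (symMat y) (Matrix.of Y)) *
            g (blockCongr A (Matrix.of Y) (symMat y))) := by
  by_cases hA : A.PosDef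
  swap
  · rw [iwDensity_of_not_posDef hA, zero_mul, lintegral_eq_zero_iff']
    · refine ae_of_all _ fun p => ?_
      simp only [Pi.zero_apply]
      rw [iwDensity_of_not_posDef, zero_mul]
      exact fun h => hA (h.submatrix Sum.inl_injective)
    · have hm : Measurable fun p : (κ → ι → ℝ) × (Sym2 κ → ℝ) =>
          fromBlocks A (Matrix.of p.1)ᵀ (Matrix.of p.1) (symMat p.2) :=
        measurable_fromBlocks measurable_const
          (measurable_transpose'.comp (measurable_of.comp measurable_fst))
          (measurable_of.comp measurable_fst) (measurable_symMat.comp measurable_snd)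
      exact (((measurable_iwDensity _ _).comp hm).mul (hg.comp hm)).aemeasurable
  set h : Matrix (ι ⊕ κ) (ι ⊕ κ) ℝ → ℝ≥0∞ := fun M => iwDensity δ (blockCongr D F V) M * g M
    with hh
  have hmh : Measurable h := (measurable_iwDensity _ _).mul hg
  have hm : Measurable fun p : Matrix κ ι ℝ × (Sym2 κ → ℝ) =>
      h (fromBlocks A p.1ᵀ p.1 (symMat p.2)) :=
    hmh.comp (measurable_fromBlocks measurable_const
      (measurable_transpose'.comp measurable_fst) measurable_fst
      (measurable_symMat.comp measurable_snd))
  have hm2 : Measurable fun p : (κ → ι → ℝ) × (Sym2 κ → ℝ) =>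
      h (blockCongr A (Matrix.of p.1) (symMat p.2)) := by
    have h1 : Measurable fun p : (κ → ι → ℝ) × (Sym2 κ → ℝ) => Matrix.of p.1 :=
      measurable_of.comp measurable_fst
    exact hmh.comp (measurable_fromBlocks measurable_const
      (measurable_mul' measurable_const (measurable_transpose'.comp h1))
      (measurable_mul' h1 measurable_const)
      (measurable_add' (measurable_symMat.comp measurable_snd)
        (measurable_mul' (measurable_mul' h1 measurable_const) (measurable_transpose'.comp h1))))
  have hAd := hA.det_pos
  have hAt := transpose_eq_of_posDef hA
  calc ∫⁻ p : (κ → ι → ℝ) × (Sym2 κ → ℝ),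
        h (fromBlocks A (Matrix.of p.1)ᵀ (Matrix.of p.1) (symMat p.2))
      = ∫⁻ f : κ → ι → ℝ, ∫⁻ y : Sym2 κ → ℝ,
          h (fromBlocks A (Matrix.of f)ᵀ (Matrix.of f) (symMat y)) := by
        rw [Measure.volume_eq_prod, lintegral_prod]
        exact hm.aemeasurable
    _ = ENNReal.ofReal (A.det ^ Fintype.card κ) * ∫⁻ Y : κ → ι → ℝ, ∫⁻ y : Sym2 κ → ℝ,
          h (fromBlocks A (Matrix.of Y * A)ᵀ (Matrix.of Y * A) (symMat y)) := by
        rw [lintegral_mul_mul (P := (1 : Matrix κ κ ℝ)) isUnit_one hA.isUnit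
          (f := fun M => ∫⁻ y : Sym2 κ → ℝ, h (fromBlocks A Mᵀ M (symMat y)))
          hm.lintegral_prod_right']
        simp [abs_of_pos hAd]
    _ = ENNReal.ofReal (A.det ^ Fintype.card κ) * ∫⁻ Y : κ → ι → ℝ, ∫⁻ y : Sym2 κ → ℝ,
          h (blockCongr A (Matrix.of Y) (symMat y)) := by
        congr 1
        refine lintegral_congr fun Y => ?_
        have hN : (Matrix.of Y * A * (Matrix.of Y)ᵀ)ᵀ = Matrix.of Y * A * (Matrix.of Y)ᵀ := by
          simp [transpose_mul, hAt, Matrix.mul_assoc]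
        rw [← lintegral_symMat_add hN
          fun M => h (fromBlocks A (Matrix.of Y * A)ᵀ (Matrix.of Y * A) M)]
        refine lintegral_congr fun y => ?_
        rw [blockCongr, transpose_mul, hAt]
    _ = ENNReal.ofReal (A.det ^ Fintype.card κ) * ∫⁻ y : Sym2 κ → ℝ, ∫⁻ Y : κ → ι → ℝ,
          h (blockCongr A (Matrix.of Y) (symMat y)) := by
        congr 1
        exact lintegral_lintegral_swap hm2.aemeasurable
    _ = _ := by
        rw [← lintegral_const_mul' _ _ ENNReal.ofReal_ne_top,
          ← lintegral_const_mul' _ _ (iwDensity_ne_top _ _ _)]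
        refine lintegral_congr fun y => ?_
        simp_rw [hh, iwDensity_blockCongr, mul_assoc]
        rw [lintegral_const_mul' _ _ ENNReal.ofReal_ne_top,
          lintegral_const_mul' _ _ (iwDensity_ne_top _ _ _),
          lintegral_const_mul' _ _ (iwDensity_ne_top _ _ _),
          lintegral_const_mul' _ _ ENNReal.ofReal_ne_top, ← mul_assoc,
          ← ENNReal.ofReal_mul (by positivity)]
        have : A.det ^ Fintype.card κ * A.det ^ (-(Fintype.card κ : ℝ)) = 1 := by
          rw [Real.rpow_neg hAd.le, Real.rpow_natCast, mul_inv_cancel₀ (by positivity)]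
        rw [this, ENNReal.ofReal_one, one_mul]

/-- The total mass of the unnormalized inverse Wishart density. -/
noncomputable def iwMass (δ : ℝ) (D : Matrix ι ι ℝ) : ℝ≥0∞ :=
  ∫⁻ y : Sym2 ι → ℝ, iwDensity δ D (symMat y)

/-- The unnormalized first moment of the quadratic form at `v` under the inverse Wishart density. -/
noncomputable def iwQuad (δ : ℝ) (D : Matrix ι ι ℝ) (v : ι → ℝ) : ℝ≥0∞ :=
  ∫⁻ y : Sym2 ι → ℝ, iwDensity δ D (symMat y) * ENNReal.ofReal (v ⬝ᵥ symMat y *ᵥ v)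

theorem measurable_quadForm {α : Type*} [MeasurableSpace α] {f : α → Matrix ι ι ℝ}
    (hf : Measurable f) (v : ι → ℝ) : Measurable fun a => v ⬝ᵥ f a *ᵥ v := by
  simp only [dotProduct, Matrix.mulVec]
  exact Finset.measurable_sum _ fun i _ => Measurable.const_mul
    (Finset.measurable_sum _ fun j _ => ((measurable_entry i j).comp hf).mul_const _) _

theorem quadForm_nonneg {M : Matrix ι ι ℝ} (hM : M.PosDef) (v : ι → ℝ) : 0 ≤ v ⬝ᵥ M *ᵥ v := by
  simpa using hM.posSemidef.dotProduct_mulVec_nonneg v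

/-- The vectors are the rows of a factor of `D⁻¹`. Writing the trace as a sum of quadratic forms
lets its mean be read off from `iwQuad`. -/
theorem trace_mul_inv_eq_sum {D : Matrix ι ι ℝ} (hD : D.PosDef) :
    ∃ Q : ι → ι → ℝ, ∀ A : Matrix ι ι ℝ, (A * D⁻¹).trace = ∑ l, Q l ⬝ᵥ A *ᵥ Q l := by
  obtain ⟨Q, -, hQ⟩ := exists_eq_transpose_mul_self hD.inv
  refine ⟨Q, fun A => ?_⟩
  rw [hQ, ← Matrix.mul_assoc, Matrix.trace_mul_comm]
  refine Finset.sum_congr rfl fun l _ => ?_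
  simp [Matrix.mul_apply, dotProduct, Matrix.mulVec]

theorem trace_mul_inv_nonneg {A D : Matrix ι ι ℝ} (hD : D.PosDef) (hA : A.PosDef) :
    0 ≤ (A * D⁻¹).trace := by
  obtain ⟨Q, hQ⟩ := trace_mul_inv_eq_sum hD
  rw [hQ]
  exact Finset.sum_nonneg fun l _ => quadForm_nonneg hA _

/-- In the factor `1 + tr(A D⁻¹)`, the `1` comes from the Schur complement itself and the trace from
the fluctuation of `Y` about `F`, whose covariance is proportional to `G`. The constant `K` does not
depend on `A`. -/
theorem exists_lintegral_slice {D : Matrix ι ι ℝ} (hD : D.PosDef) (κ : Type*) [Fintype κ]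
    [DecidableEq κ] :
    ∃ K : ℝ≥0∞, K ≠ 0 ∧ K ≠ ⊤ ∧ ∀ (δ : ℝ) (F : Matrix κ ι ℝ) (V : Matrix κ κ ℝ)
      (A : Matrix ι ι ℝ),
      ∫⁻ p : (κ → ι → ℝ) × (Sym2 κ → ℝ), iwDensity δ (blockCongr D F V)
        (fromBlocks A (Matrix.of p.1)ᵀ (Matrix.of p.1) (symMat p.2)) =
          iwDensity δ D A * (K * iwMass (δ + Fintype.card ι) V) ∧
      ∀ (v : ι → ℝ) (w : κ → ℝ), ∫⁻ p : (κ → ι → ℝ) × (Sym2 κ → ℝ),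
        iwDensity δ (blockCongr D F V)
          (fromBlocks A (Matrix.of p.1)ᵀ (Matrix.of p.1) (symMat p.2)) *
          ENNReal.ofReal (Sum.elim v w ⬝ᵥ
            (fromBlocks A (Matrix.of p.1)ᵀ (Matrix.of p.1) (symMat p.2)) *ᵥ Sum.elim v w) =
        iwDensity δ D A * (K * (ENNReal.ofReal ((v + Fᵀ *ᵥ w) ⬝ᵥ A *ᵥ (v + Fᵀ *ᵥ w)) *
          iwMass (δ + Fintype.card ι) V +
          ENNReal.ofReal (1 + (A * D⁻¹).trace) * iwQuad (δ + Fintype.card ι) V w)) := by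
  obtain ⟨K, h0, h1, hK⟩ := exists_lintegral_regDensity hD κ
  have hdet : ∀ G : Matrix κ κ ℝ, G.PosDef →
      ENNReal.ofReal (G.det ^ (-(Fintype.card ι : ℝ) / 2)) *
        ENNReal.ofReal (G.det ^ ((Fintype.card ι : ℝ) / 2)) = 1 := by
    intro G hG
    have := hG.det_pos
    rw [← ENNReal.ofReal_mul (by positivity), ← Real.rpow_add this]
    simp [neg_div]
  refine ⟨K, h0, h1, fun δ F V A => ⟨?_, fun v w => ?_⟩⟩
  · have h := lintegral_iwDensity_slice δ D F V A (g := fun _ => 1) measurable_const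
    simp only [mul_one] at h
    rw [h, iwMass, ← lintegral_const_mul' _ _ h1]
    congr 1
    refine lintegral_congr fun y => ?_
    by_cases hG : (symMat y).PosDef
    · rw [(hK F _ hG).1, ← mul_assoc (ENNReal.ofReal _), hdet _ hG, one_mul, mul_comm]
    · simp [iwDensity_of_not_posDef hG]
  · rw [lintegral_iwDensity_slice δ D F V A (g := fun M =>
      ENNReal.ofReal (Sum.elim v w ⬝ᵥ M *ᵥ Sum.elim v w))
      (measurable_quadForm measurable_id _).ennreal_ofReal]
    by_cases hA : A.PosDef
    swap
    · simp [iwDensity_of_not_posDef hA]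
    have htr := trace_mul_inv_nonneg hD hA
    congr 1
    set u := v + Fᵀ *ᵥ w with hu
    have hmd : Measurable fun y : Sym2 κ → ℝ => iwDensity (δ + Fintype.card ι) V (symMat y) :=
      (measurable_iwDensity _ _).comp measurable_symMat
    rw [iwMass, iwQuad, ← lintegral_const_mul' _ _ ENNReal.ofReal_ne_top,
      ← lintegral_const_mul' _ _ ENNReal.ofReal_ne_top, ← lintegral_add_left (hmd.const_mul _),
      ← lintegral_const_mul' _ _ h1]
    refine lintegral_congr fun y => ?_
    by_cases hG : (symMat y).PosDef
    swap
    · simp [iwDensity_of_not_posDef hG]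
    have hw := quadForm_nonneg hG w
    have huA := quadForm_nonneg hA u
    have e : ∫⁻ Y : κ → ι → ℝ, ENNReal.ofReal (regDensity D F (symMat y) (Matrix.of Y)) *
        ENNReal.ofReal (Sum.elim v w ⬝ᵥ blockCongr A (Matrix.of Y) (symMat y) *ᵥ Sum.elim v w) =
        ENNReal.ofReal ((symMat y).det ^ ((Fintype.card ι : ℝ) / 2)) * K *
          ENNReal.ofReal (u ⬝ᵥ A *ᵥ u + (1 + (A * D⁻¹).trace) * (w ⬝ᵥ symMat y *ᵥ w)) := by
      have e1 : ∀ Y : κ → ι → ℝ,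
          ENNReal.ofReal (Sum.elim v w ⬝ᵥ blockCongr A (Matrix.of Y) (symMat y) *ᵥ Sum.elim v w) =
          ENNReal.ofReal ((v + (Matrix.of Y)ᵀ *ᵥ w) ⬝ᵥ A *ᵥ (v + (Matrix.of Y)ᵀ *ᵥ w)) +
            ENNReal.ofReal (w ⬝ᵥ symMat y *ᵥ w) := fun Y => by
        rw [blockCongr_quadForm A, ENNReal.ofReal_add (quadForm_nonneg hA _) hw]
      simp_rw [e1, mul_add]
      rw [lintegral_add_right', lintegral_mul_const' _ _ ENNReal.ofReal_ne_top, (hK F _ hG).1,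
        (hK F _ hG).2 A v w hA, ← mul_add, ← ENNReal.ofReal_add (by positivity) hw]
      · congr 2; ring
      · refine (Measurable.mul_const (Measurable.ennreal_ofReal ?_) _).aemeasurable
        have hs : Measurable fun Y : κ → ι → ℝ => Matrix.of Y - F := by
          refine measurable_matrix fun k i => ?_
          simp only [Matrix.sub_apply, Matrix.of_apply]
          fun_prop
        exact Real.measurable_exp.comp ((measurable_trace' (measurable_mul' measurable_const
          (measurable_mul' (measurable_mul' hs measurable_const)
            (measurable_transpose'.comp hs)))).neg.div_const _)
    rw [e, ← mul_assoc (ENNReal.ofReal _), ← mul_assoc (ENNReal.ofReal _), hdet _ hG, one_mul,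
      ENNReal.ofReal_add huA (by positivity), ENNReal.ofReal_mul (by positivity)]
    ring

end Slice

end IWAR

namespace IWAR

/-! ### Normalizing constant and mean of the inverse Wishart law, by induction on the dimension. -/

section Moments

/-- The substitution `t ↦ t⁻¹` reduces this to the Gamma integral. -/
theorem lintegral_inverse_gamma {s r : ℝ} (hs : 0 < s) (hr : 0 < r) :
    ∫⁻ t in Set.Ioi (0 : ℝ), ENNReal.ofReal (t ^ (-s - 1) * Real.exp (-(r * t⁻¹))) =
      ENNReal.ofReal ((1 / r) ^ s * Real.Gamma s) := by
  have hI := Real.integral_rpow_mul_exp_neg_mul_Ioi hs hr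
  have hpos : 0 < (1 / r) ^ s * Real.Gamma s := by
    have := Real.Gamma_pos_of_pos hs
    positivity
  -- A non-integrable function has Bochner integral `0` by convention, which the positive value in
  -- `hI` excludes.
  have hint : IntegrableOn (fun t : ℝ => t ^ (s - 1) * Real.exp (-(r * t))) (Set.Ioi 0) := by
    by_contra h
    rw [integral_undef h] at hI
    exact hpos.ne hI
  have hcongr : ∀ t ∈ Set.Ioi (0 : ℝ), (|(-1 : ℝ)| * t ^ ((-1 : ℝ) - 1)) •
      ((t ^ (-1 : ℝ)) ^ (s - 1) * Real.exp (-(r * t ^ (-1 : ℝ)))) =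
      t ^ (-s - 1) * Real.exp (-(r * t⁻¹)) := by
    intro t ht
    have ht' : 0 < t := ht
    rw [← Real.rpow_mul ht'.le, Real.rpow_neg_one, smul_eq_mul, abs_neg, abs_one, one_mul,
      ← mul_assoc, ← Real.rpow_add ht']
    congr 2; ring
  have h1 := integral_comp_rpow_Ioi (fun t : ℝ => t ^ (s - 1) * Real.exp (-(r * t)))
    (p := -1) (by norm_num)
  have h2 := (integrableOn_Ioi_comp_rpow_iff
    (fun t : ℝ => t ^ (s - 1) * Real.exp (-(r * t))) (p := -1) (by norm_num)).2 hint
  rw [setIntegral_congr_fun measurableSet_Ioi hcongr, hI] at h1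
  replace h2 := h2.congr_fun hcongr measurableSet_Ioi
  rw [← h1, ofReal_integral_eq_lintegral_ofReal h2]
  filter_upwards [ae_restrict_mem measurableSet_Ioi] with t ht
  have ht' : 0 < t := ht
  simp only [Pi.zero_apply]
  positivity

/-- The normalizing constant of the inverse Wishart density is finite, and its first moment, where
it exists, is that of a distribution with mean `D / (δ - 2)`. -/
def HasIWMoments (ι : Type*) [Fintype ι] [DecidableEq ι] : Prop :=
  ∀ (δ : ℝ) (D : Matrix ι ι ℝ), 0 < δ → D.PosDef →
    iwMass δ D ≠ 0 ∧ iwMass δ D ≠ ⊤ ∧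
      (2 < δ → ∀ v, iwQuad δ D v = ENNReal.ofReal (v ⬝ᵥ D *ᵥ v / (δ - 2)) * iwMass δ D)

theorem lintegral_symMat_unique {ι : Type*} [Fintype ι] [Unique ι] (f : Matrix ι ι ℝ → ℝ≥0∞) :
    ∫⁻ y : Sym2 ι → ℝ, f (symMat y) = ∫⁻ t : ℝ, f (Matrix.of fun _ _ => t) := by
  rw [← (volume_preserving_funUnique (Sym2 ι) ℝ).lintegral_comp_emb
    (MeasurableEquiv.measurableEmbedding _)]
  have h : ∀ y : Sym2 ι → ℝ,
      symMat y = Matrix.of fun _ _ => MeasurableEquiv.funUnique (Sym2 ι) ℝ y := fun y => by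
    ext i j
    simp only [symMat, Matrix.of_apply, MeasurableEquiv.funUnique]
    exact congrArg y (Subsingleton.elim _ _)
  simp_rw [h]
  congr!

/-- A `1 × 1` inverse Wishart variable is inverse gamma with shape `δ / 2` and scale `d / 2`; the
mean follows from `Γ(s + 1) = s Γ(s)`. -/
theorem hasIWMoments_unique (ι : Type*) [Fintype ι] [DecidableEq ι] [Unique ι] :
    HasIWMoments ι := by
  intro δ D hδ hD
  have hd : 0 < D default default := hD.diag_pos
  set d := D default default with hd_def
  have hpd : ∀ t : ℝ, (Matrix.of fun _ _ => t : Matrix ι ι ℝ).PosDef ↔ 0 < t := by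
    intro t
    constructor
    · intro h; exact h.diag_pos (i := default)
    · intro h
      have : (Matrix.of fun _ _ => t : Matrix ι ι ℝ) = t • (1 : Matrix ι ι ℝ) := by
        ext i j; simp [Subsingleton.elim i j]
      rw [this]
      exact Matrix.PosDef.one.smul h
  have hdens : ∀ t : ℝ, iwDensity δ D (Matrix.of fun _ _ => t) =
      (Set.Ioi (0 : ℝ)).indicator (fun t => ENNReal.ofReal
        (t ^ (-(δ / 2) - 1) * Real.exp (-(d / 2 * t⁻¹)))) t := by
    intro t
    by_cases ht : 0 < t
    · rw [iwDensity_of_posDef ((hpd t).2 ht), Set.indicator_of_mem (Set.mem_Ioi.2 ht)]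
      have hinv : (Matrix.of fun _ _ => t : Matrix ι ι ℝ)⁻¹ = Matrix.of fun _ _ => t⁻¹ := by
        apply Matrix.inv_eq_right_inv
        ext i j
        simp [Matrix.mul_apply, ht.ne', Subsingleton.elim i j, Matrix.one_apply]
      have htr : (D * (Matrix.of fun _ _ => t : Matrix ι ι ℝ)⁻¹).trace = d * t⁻¹ := by
        rw [hinv]; simp [Matrix.trace, Matrix.mul_apply, hd_def]
      rw [htr, Matrix.det_unique]
      simp only [Matrix.of_apply, Fintype.card_unique]
      congr 3
      · push_cast; ring
      · ring
    · rw [iwDensity_of_not_posDef (mt (hpd t).1 ht), Set.indicator_of_notMem (mt Set.mem_Ioi.1 ht)]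
  have hmass : iwMass δ D = ENNReal.ofReal ((1 / (d / 2)) ^ (δ / 2) * Real.Gamma (δ / 2)) := by
    rw [iwMass, lintegral_symMat_unique]
    simp_rw [hdens]
    rw [lintegral_indicator measurableSet_Ioi,
      lintegral_inverse_gamma (by positivity) (by positivity)]
  have hpos : 0 < (1 / (d / 2)) ^ (δ / 2) * Real.Gamma (δ / 2) := by
    have := Real.Gamma_pos_of_pos (half_pos hδ)
    positivity
  refine ⟨?_, ?_, fun h2 v => ?_⟩
  · rw [hmass]; exact (ENNReal.ofReal_pos.2 hpos).ne'
  · rw [hmass]; exact ENNReal.ofReal_ne_top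
  · rw [iwQuad, lintegral_symMat_unique fun M => iwDensity δ D M * ENNReal.ofReal (v ⬝ᵥ M *ᵥ v)]
    have hq : ∀ t : ℝ, iwDensity δ D (Matrix.of fun _ _ => t) *
        ENNReal.ofReal (v ⬝ᵥ (Matrix.of fun _ _ => t : Matrix ι ι ℝ) *ᵥ v) =
        ENNReal.ofReal (v default ^ 2) * (Set.Ioi (0 : ℝ)).indicator (fun t => ENNReal.ofReal
          (t ^ (-(δ / 2 - 1) - 1) * Real.exp (-(d / 2 * t⁻¹)))) t := by
      intro t
      rw [hdens]
      by_cases ht : 0 < t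
      · rw [Set.indicator_of_mem (Set.mem_Ioi.2 ht), Set.indicator_of_mem (Set.mem_Ioi.2 ht),
          ← ENNReal.ofReal_mul (by positivity), ← ENNReal.ofReal_mul (by positivity)]
        congr 1
        have : t ^ (-(δ / 2 - 1) - 1) = t ^ (-(δ / 2) - 1) * t := by
          rw [← Real.rpow_add_one ht.ne']; congr 1; ring
        rw [this]
        simp [dotProduct, Matrix.mulVec]
        ring
      · rw [Set.indicator_of_notMem (mt Set.mem_Ioi.1 ht),
          Set.indicator_of_notMem (mt Set.mem_Ioi.1 ht)]; simp
    simp_rw [hq]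
    rw [lintegral_const_mul' _ _ ENNReal.ofReal_ne_top, lintegral_indicator measurableSet_Ioi,
      lintegral_inverse_gamma (by linarith) (by positivity), hmass,
      ← ENNReal.ofReal_mul (by positivity), ← ENNReal.ofReal_mul]
    · congr 1
      have hs : 0 < δ / 2 - 1 := by linarith
      have hG : Real.Gamma (δ / 2) = (δ / 2 - 1) * Real.Gamma (δ / 2 - 1) := by
        rw [← Real.Gamma_add_one hs.ne']; congr 1; ring
      have hr : (1 / (d / 2)) ^ (δ / 2) = (1 / (d / 2)) ^ (δ / 2 - 1) * (1 / (d / 2)) := by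
        rw [← Real.rpow_add_one (by positivity)]; congr 1; ring
      have hvD : v ⬝ᵥ D *ᵥ v = v default ^ 2 * d := by
        simp [dotProduct, Matrix.mulVec, hd_def]; ring
      rw [hG, hr, hvD]
      have : δ - 2 ≠ 0 := by linarith
      field_simp
    · exact div_nonneg (quadForm_nonneg hD v) (by linarith)

variable {ι κ : Type*} [Fintype ι] [DecidableEq ι] [Fintype κ] [DecidableEq κ]

theorem hasIWMoments_of_isEmpty [IsEmpty ι] : HasIWMoments ι := by
  intro δ D hδ hD
  have hM : ∀ M : Matrix ι ι ℝ, iwDensity δ D M = 1 := by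
    intro M
    have : M.PosDef := by
      rw [Subsingleton.elim M 1]; exact Matrix.PosDef.one
    rw [iwDensity_of_posDef this]
    simp [Matrix.trace]
  have hmass : iwMass δ D = 1 := by
    simp [iwMass, hM, volume_pi]
  refine ⟨by simp [hmass], by simp [hmass], fun _ v => ?_⟩
  simp [iwQuad, hM]

theorem HasIWMoments.of_equiv (h : HasIWMoments ι) (e : ι ≃ κ) : HasIWMoments κ := by
  intro δ D hδ hD
  have hpd : ∀ M : Matrix κ κ ℝ, (M.submatrix e e).PosDef ↔ M.PosDef := by
    intro M
    constructor
    · intro h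
      simpa using h.submatrix e.symm.injective
    · intro h
      exact h.submatrix e.injective
  have hdens : ∀ M : Matrix κ κ ℝ, iwDensity δ D M =
      iwDensity δ (D.submatrix e e) (M.submatrix e e) := by
    intro M
    by_cases hM : M.PosDef
    · rw [iwDensity_of_posDef hM, iwDensity_of_posDef ((hpd M).2 hM), Matrix.inv_submatrix_equiv,
        Matrix.submatrix_mul_equiv, Matrix.det_submatrix_equiv_self, Fintype.card_congr e]
      congr 4
      simp only [Matrix.trace, Matrix.diag_apply, Matrix.submatrix_apply]
      rw [← e.sum_comp]
    · rw [iwDensity_of_not_posDef hM, iwDensity_of_not_posDef (mt (hpd M).1 hM)]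
  have hquad : ∀ (M : Matrix κ κ ℝ) (v : κ → ℝ),
      v ⬝ᵥ M *ᵥ v = (v ∘ e) ⬝ᵥ (M.submatrix e e) *ᵥ (v ∘ e) := by
    intro M v
    simp only [dotProduct, Matrix.mulVec, Function.comp_apply, Matrix.submatrix_apply]
    rw [← e.sum_comp]
    refine Finset.sum_congr rfl fun i _ => ?_
    rw [← e.sum_comp]
  have hmass : iwMass δ D = iwMass δ (D.submatrix e e) := by
    rw [iwMass, iwMass, ← lintegral_symMat_submatrix e]
    simp_rw [hdens]
  have hq : ∀ v, iwQuad δ D v = iwQuad δ (D.submatrix e e) (v ∘ e) := by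
    intro v
    rw [iwQuad, iwQuad, ← lintegral_symMat_submatrix e fun M =>
      iwDensity δ (D.submatrix e e) M * ENNReal.ofReal ((v ∘ e) ⬝ᵥ M *ᵥ (v ∘ e))]
    simp_rw [hdens, ← hquad]
  rw [hmass]
  obtain ⟨h1, h2, h3⟩ := h δ (D.submatrix e e) hδ ((hpd D).2 hD)
  exact ⟨h1, h2, fun hδ2 v => by rw [hq, h3 hδ2, hquad D v]⟩

/-- The mean is `D / (δ - 2)` and `tr(D D⁻¹)` is the dimension. -/
theorem HasIWMoments.lintegral_trace (h : HasIWMoments ι) {δ : ℝ} (hδ : 2 < δ)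
    {D : Matrix ι ι ℝ} (hD : D.PosDef) :
    ∫⁻ x : Sym2 ι → ℝ, iwDensity δ D (symMat x) * ENNReal.ofReal (1 + (symMat x * D⁻¹).trace) =
      ENNReal.ofReal (1 + Fintype.card ι / (δ - 2)) * iwMass δ D := by
  obtain ⟨Q, hQ⟩ := trace_mul_inv_eq_sum hD
  have hm : Measurable fun x : Sym2 ι → ℝ => iwDensity δ D (symMat x) :=
    (measurable_iwDensity _ _).comp measurable_symMat
  have hδ' : 0 < δ - 2 := by linarith
  have e : ∀ x : Sym2 ι → ℝ, iwDensity δ D (symMat x) *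
      ENNReal.ofReal (1 + (symMat x * D⁻¹).trace) = iwDensity δ D (symMat x) +
        ∑ l, iwDensity δ D (symMat x) * ENNReal.ofReal (Q l ⬝ᵥ symMat x *ᵥ Q l) := by
    intro x
    by_cases hx : (symMat x).PosDef
    · rw [ENNReal.ofReal_add zero_le_one (trace_mul_inv_nonneg hD hx), hQ,
        ENNReal.ofReal_sum_of_nonneg fun l _ => quadForm_nonneg hx _, ENNReal.ofReal_one, mul_add,
        mul_one, Finset.mul_sum]
    · simp [iwDensity_of_not_posDef hx]
  simp_rw [e]
  rw [lintegral_add_left hm, lintegral_finsetSum]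
  · have h1 : ∀ l, ∫⁻ x : Sym2 ι → ℝ, iwDensity δ D (symMat x) *
        ENNReal.ofReal (Q l ⬝ᵥ symMat x *ᵥ Q l) =
        ENNReal.ofReal (Q l ⬝ᵥ D *ᵥ Q l / (δ - 2)) * iwMass δ D := fun l =>
      (h δ D (by linarith) hD).2.2 hδ (Q l)
    simp_rw [h1]
    have hd : IsUnit D.det := (Matrix.isUnit_iff_isUnit_det _).1 hD.isUnit
    rw [← Finset.sum_mul, ← ENNReal.ofReal_sum_of_nonneg fun l _ =>
      div_nonneg (quadForm_nonneg hD _) hδ'.le, ← Finset.sum_div, ← hQ,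
      Matrix.mul_nonsing_inv _ hd, Matrix.trace_one,
      ENNReal.ofReal_add zero_le_one (by positivity), ENNReal.ofReal_one, add_mul, one_mul, iwMass]
  · intro l _
    exact hm.mul (measurable_quadForm measurable_symMat _).ennreal_ofReal

/-- Inductive step: the slice formula is integrated over the first block, itself inverse Wishart
with scale `D` and the same `δ`, while the Schur complement has `δ + card ι` degrees of freedom. -/
theorem HasIWMoments.sum (hι : HasIWMoments ι) (hκ : HasIWMoments κ) : HasIWMoments (ι ⊕ κ) := by
  intro δ M hδ hM
  obtain ⟨D, F, V, hD, hV, rfl⟩ := exists_eq_blockCongr hM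
  obtain ⟨K, h0, h1, hK⟩ := exists_lintegral_slice hD κ
  obtain ⟨hι0, hι1, hι2⟩ := hι δ D hδ hD
  obtain ⟨hκ0, hκ1, hκ2⟩ := hκ (δ + Fintype.card ι) V (by positivity) hV
  have hmass : iwMass δ (blockCongr D F V) =
      iwMass δ D * (K * iwMass (δ + Fintype.card ι) V) := by
    rw [iwMass, lintegral_symMat_sum (measurable_iwDensity _ _)]
    simp_rw [fun x : Sym2 ι → ℝ => (hK δ F V (symMat x)).1]
    exact lintegral_mul_const' _ _ (ENNReal.mul_ne_top h1 hκ1)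
  rw [hmass]
  refine ⟨mul_ne_zero hι0 (mul_ne_zero h0 hκ0),
    ENNReal.mul_ne_top hι1 (ENNReal.mul_ne_top h1 hκ1), fun hδ2 x => ?_⟩
  have hδ' : 0 < δ - 2 := by linarith
  have hδ'' : 0 < δ + Fintype.card ι - 2 := by
    have : (0 : ℝ) ≤ Fintype.card ι := by positivity
    linarith
  obtain ⟨v, w, rfl⟩ : ∃ v w, x = Sum.elim v w := ⟨_, _, (Sum.elim_comp_inl_inr x).symm⟩
  have hq1 := hι2 hδ2 (v + Fᵀ *ᵥ w)
  have hq2 := hκ2 (by linarith) w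
  have ht := hι.lintegral_trace hδ2 hD
  have hu := quadForm_nonneg hD (v + Fᵀ *ᵥ w)
  have hw := quadForm_nonneg hV w
  rw [iwQuad, lintegral_symMat_sum (f := fun M => iwDensity δ (blockCongr D F V) M *
    ENNReal.ofReal (Sum.elim v w ⬝ᵥ M *ᵥ Sum.elim v w))
    ((measurable_iwDensity _ _).mul (measurable_quadForm measurable_id _).ennreal_ofReal)]
  simp_rw [fun x : Sym2 ι → ℝ => (hK δ F V (symMat x)).2 v w]
  have hm : Measurable fun x : Sym2 ι → ℝ => iwDensity δ D (symMat x) :=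
    (measurable_iwDensity _ _).comp measurable_symMat
  have hqtop : iwQuad (δ + Fintype.card ι) V w ≠ ⊤ := by
    rw [hq2]; exact ENNReal.mul_ne_top ENNReal.ofReal_ne_top hκ1
  have e : ∀ x : Sym2 ι → ℝ, iwDensity δ D (symMat x) *
      (K * (ENNReal.ofReal ((v + Fᵀ *ᵥ w) ⬝ᵥ symMat x *ᵥ (v + Fᵀ *ᵥ w)) *
        iwMass (δ + Fintype.card ι) V + ENNReal.ofReal (1 + (symMat x * D⁻¹).trace) *
        iwQuad (δ + Fintype.card ι) V w)) =
      K * (iwMass (δ + Fintype.card ι) V * (iwDensity δ D (symMat x) *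
        ENNReal.ofReal ((v + Fᵀ *ᵥ w) ⬝ᵥ symMat x *ᵥ (v + Fᵀ *ᵥ w))) +
        iwQuad (δ + Fintype.card ι) V w * (iwDensity δ D (symMat x) *
          ENNReal.ofReal (1 + (symMat x * D⁻¹).trace))) := fun x => by ring
  simp_rw [e]
  rw [lintegral_const_mul' _ _ h1, lintegral_add_left, lintegral_const_mul' _ _ hκ1,
    lintegral_const_mul' _ _ hqtop, ht, hq2]
  · change K * (_ * iwQuad δ D (v + Fᵀ *ᵥ w) + _) = _
    rw [hq1, blockCongr_quadForm]
    -- With `p = card ι`, this rests on `(1 + p / (δ - 2)) / (δ + p - 2) = 1 / (δ - 2)`.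
    have : (v + Fᵀ *ᵥ w) ⬝ᵥ D *ᵥ (v + Fᵀ *ᵥ w) / (δ - 2) +
        w ⬝ᵥ V *ᵥ w / (δ + Fintype.card ι - 2) * (1 + Fintype.card ι / (δ - 2)) =
        ((v + Fᵀ *ᵥ w) ⬝ᵥ D *ᵥ (v + Fᵀ *ᵥ w) + w ⬝ᵥ V *ᵥ w) / (δ - 2) := by
      field_simp
      ring
    rw [← this, ENNReal.ofReal_add (p := (v + Fᵀ *ᵥ w) ⬝ᵥ D *ᵥ (v + Fᵀ *ᵥ w) / (δ - 2))
        (by positivity) (by positivity),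
      ENNReal.ofReal_mul (p := w ⬝ᵥ V *ᵥ w / (δ + Fintype.card ι - 2)) (by positivity)]
    ring
  · exact (hm.mul (measurable_quadForm measurable_symMat _).ennreal_ofReal).const_mul _

theorem hasIWMoments (ι : Type*) [hι : Fintype ι] [hd : DecidableEq ι] : HasIWMoments ι := by
  classical
  -- Decidable equality is quantified inside the motive, since the induction changes the index type.
  have key : ∀ [DecidableEq ι], HasIWMoments ι := by
    refine Fintype.induction_empty_option
      (P := fun α _ => ∀ [DecidableEq α], HasIWMoments α) ?_ ?_ ?_ ι
    · intro α β _ e h _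
      let _ := Fintype.ofEquiv β e.symm
      classical
      have h' : HasIWMoments α := h
      convert h'.of_equiv e
    · intro _
      exact hasIWMoments_of_isEmpty
    · intro α _ h _
      classical
      exact (HasIWMoments.sum h (hasIWMoments_unique PUnit.{1})).of_equiv
        (Equiv.optionEquivSumPUnit α).symm
  exact key

end Moments

end IWAR

namespace IWAR

/-! ### The transition kernel: its total mass, its mean, and its role as conditional law in the
pair. -/

section Transition

variable {ι : Type*} [Fintype ι] [DecidableEq ι]

/-- Polarization, the passage from moments of quadratic forms to moments of entries. -/
theorem entry_eq_quadForm {M : Matrix ι ι ℝ} (hM : Mᵀ = M) (i j : ι) :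
    M i j = ((Pi.single i 1 + Pi.single j 1) ⬝ᵥ M *ᵥ (Pi.single i 1 + Pi.single j 1) -
      (Pi.single i 1 - Pi.single j 1) ⬝ᵥ M *ᵥ (Pi.single i 1 - Pi.single j 1)) / 4 := by
  have h : M j i = M i j := congrFun (congrFun hM i) j
  simp only [Matrix.mulVec_add, Matrix.mulVec_sub, add_dotProduct, sub_dotProduct, dotProduct_add,
    dotProduct_sub, single_one_dotProduct, Matrix.mulVec_single_one, Matrix.col_apply, h]
  ring

theorem integrable_quadForm {Ω : Type*} [MeasurableSpace Ω] {μ : Measure Ω}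
    {X : Ω → Matrix ι ι ℝ} (hX : Measurable X) (hpd : ∀ᵐ ω ∂μ, (X ω).PosDef) {v : ι → ℝ}
    (hfin : ∫⁻ ω, ENNReal.ofReal (v ⬝ᵥ X ω *ᵥ v) ∂μ ≠ ⊤) :
    Integrable (fun ω => v ⬝ᵥ X ω *ᵥ v) μ := by
  refine ⟨(measurable_quadForm hX v).aestronglyMeasurable, ?_⟩
  rw [hasFiniteIntegral_iff_ofReal]
  · exact hfin.lt_top
  · filter_upwards [hpd] with ω h using quadForm_nonneg h v

theorem integrable_entry {Ω : Type*} [MeasurableSpace Ω] {μ : Measure Ω}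
    {X : Ω → Matrix ι ι ℝ} (hX : Measurable X) (hpd : ∀ᵐ ω ∂μ, (X ω).PosDef)
    (hfin : ∀ v, ∫⁻ ω, ENNReal.ofReal (v ⬝ᵥ X ω *ᵥ v) ∂μ ≠ ⊤) (i j : ι) :
    Integrable (fun ω => X ω i j) μ := by
  have h := ((integrable_quadForm hX hpd (hfin (Pi.single i 1 + Pi.single j 1))).sub
    (integrable_quadForm hX hpd (hfin (Pi.single i 1 - Pi.single j 1)))).div_const 4
  refine h.congr ?_
  filter_upwards [hpd] with ω hω
  exact (entry_eq_quadForm (transpose_eq_of_posDef hω) i j).symm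

theorem integral_entry {μ : Measure (Matrix ι ι ℝ)} (hpd : ∀ᵐ M ∂μ, M.PosDef)
    {L : Matrix ι ι ℝ} (hL : L.PosDef)
    (h : ∀ v, ∫⁻ M, ENNReal.ofReal (v ⬝ᵥ M *ᵥ v) ∂μ = ENNReal.ofReal (v ⬝ᵥ L *ᵥ v)) (i j : ι) :
    ∫ M, M i j ∂μ = L i j := by
  have hfin : ∀ v, ∫⁻ M, ENNReal.ofReal (v ⬝ᵥ M *ᵥ v) ∂μ ≠ ⊤ := fun v => by
    rw [h]; exact ENNReal.ofReal_ne_top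
  have hint : ∀ v, Integrable (fun M => v ⬝ᵥ M *ᵥ v) μ := fun v =>
    integrable_quadForm measurable_id hpd (hfin v)
  have hI : ∀ v, ∫ M, v ⬝ᵥ M *ᵥ v ∂μ = v ⬝ᵥ L *ᵥ v := by
    intro v
    have h2 := h v
    have hnn : 0 ≤ᵐ[μ] fun M : Matrix ι ι ℝ => v ⬝ᵥ M *ᵥ v := by
      filter_upwards [hpd] with M hM using quadForm_nonneg hM v
    rw [← ofReal_integral_eq_lintegral_ofReal (hint v) hnn] at h2
    exact (ENNReal.ofReal_eq_ofReal_iff (integral_nonneg_of_ae hnn) (quadForm_nonneg hL v)).1 h2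
  have : (fun M : Matrix ι ι ℝ => M i j) =ᵐ[μ] fun M =>
      ((Pi.single i 1 + Pi.single j 1) ⬝ᵥ M *ᵥ (Pi.single i 1 + Pi.single j 1) -
      (Pi.single i 1 - Pi.single j 1) ⬝ᵥ M *ᵥ (Pi.single i 1 - Pi.single j 1)) / 4 := by
    filter_upwards [hpd] with M hM using entry_eq_quadForm (transpose_eq_of_posDef hM) i j
  rw [integral_congr_ae this, integral_div, integral_sub (hint _) (hint _), hI, hI,
    ← entry_eq_quadForm (transpose_eq_of_posDef hL)]

/-- The conditional mean of the next state given the present state `A`. -/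
noncomputable def meanMap (n : ℝ) (S F A : Matrix ι ι ℝ) : Matrix ι ι ℝ :=
  F * A * Fᵀ + (cnq n (Fintype.card ι) * (1 + n⁻¹ * (A * S⁻¹).trace)) • (S - F * S * Fᵀ)

/-- Places the augmented scale in Schur coordinates: the autoregression matrix `F` is the regression
matrix. -/
theorem augScale_eq_blockCongr (n : ℝ) (S F : Matrix ι ι ℝ) :
    augScale n S F = blockCongr (n • S) F (n • (S - F * S * Fᵀ)) := by
  rw [augScale, blockCongr, fromBlocks_smul]
  congr 1
  · simp
  · simp
  · simp [smul_sub]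

variable {n : ℝ} {S F : Matrix ι ι ℝ}

theorem posDef_augScale (hn : 0 < n) (hS : S.PosDef) (hV : (S - F * S * Fᵀ).PosDef) :
    (augScale n S F).PosDef := by
  rw [augScale_eq_blockCongr, posDef_blockCongr]
  exact ⟨hS.smul hn, hV.smul hn⟩

theorem posDef_meanMap (hn : 0 < n) (hS : S.PosDef) (hV : (S - F * S * Fᵀ).PosDef)
    {A : Matrix ι ι ℝ} (hA : A.PosDef) : (meanMap n S F A).PosDef := by
  have h1 : (F * A * Fᵀ).PosSemidef := by
    rw [← conjTranspose_eq_transpose_of_trivial]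
    exact hA.posSemidef.mul_mul_conjTranspose_same F
  have h2 : 0 < cnq n (Fintype.card ι) * (1 + n⁻¹ * (A * S⁻¹).trace) := by
    have := trace_mul_inv_nonneg hS hA
    unfold cnq
    positivity
  exact Matrix.PosDef.posSemidef_add h1 (hV.smul h2)

theorem sliceDensity_eq (n : ℝ) (S F A : Matrix ι ι ℝ) (p : (ι → ι → ℝ) × (Sym2 ι → ℝ)) :
    sliceDensity n S F A p = iwDensity (n + 2) (blockCongr (n • S) F (n • (S - F * S * Fᵀ)))
      (fromBlocks A (Matrix.of p.1)ᵀ (Matrix.of p.1) (symMat p.2)) := by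
  rw [sliceDensity, augScale_eq_blockCongr]

theorem measurable_sliceDensity_right (n : ℝ) (S F A : Matrix ι ι ℝ) :
    Measurable (sliceDensity n S F A) :=
  (measurable_sliceDensity n S F).comp measurable_prodMk_left

theorem lintegral_transitionKernel (A : Matrix ι ι ℝ) {f : Matrix ι ι ℝ → ℝ≥0∞}
    (hf : Measurable f) :
    ∫⁻ M, f M ∂(transitionKernel n S F A) =
      (∫⁻ p, sliceDensity n S F A p)⁻¹ * ∫⁻ p, sliceDensity n S F A p * f (symMat p.2) := by
  have hm : Measurable fun p : (ι → ι → ℝ) × (Sym2 ι → ℝ) => symMat p.2 :=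
    measurable_symMat.comp measurable_snd
  change ∫⁻ M, f M ∂(transitionLaw n S F A) = _
  rw [transitionLaw, lintegral_map hf hm, normalize, lintegral_smul_measure,
    lintegral_withDensity_eq_lintegral_mul _ (measurable_sliceDensity_right n S F A)
      (g := fun p => f (symMat p.2)) (hf.comp hm), withDensity_apply _ MeasurableSet.univ, Measure.restrict_univ]
  rfl

theorem sliceDensity_of_not_posDef {A : Matrix ι ι ℝ} (hA : ¬ A.PosDef)
    (p : (ι → ι → ℝ) × (Sym2 ι → ℝ)) : sliceDensity n S F A p = 0 :=
  iwDensity_of_not_posDef fun h => hA (h.submatrix Sum.inl_injective)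

/-- The slice formula with test vector `(0, w)`. The Schur complement has `n + 2 + q` degrees of
freedom, hence mean `n (S - F S F') / (n + q)`, which is where `cnq` comes from. -/
theorem exists_sliceMass (hn : 0 < n) (hS : S.PosDef) (hV : (S - F * S * Fᵀ).PosDef) :
    ∃ K : ℝ≥0∞, K ≠ 0 ∧ K ≠ ⊤ ∧
      (∀ A, ∫⁻ p, sliceDensity n S F A p = iwDensity (n + 2) (n • S) A * K) ∧
      ∀ A, A.PosDef → ∀ w, ∫⁻ p, sliceDensity n S F A p * ENNReal.ofReal (w ⬝ᵥ symMat p.2 *ᵥ w) =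
        iwDensity (n + 2) (n • S) A * K * ENNReal.ofReal (w ⬝ᵥ meanMap n S F A *ᵥ w) := by
  obtain ⟨K, h0, h1, hK⟩ := exists_lintegral_slice (hS.smul hn) ι
  set q := Fintype.card ι with hq
  obtain ⟨hm0, hm1, hm2⟩ := hasIWMoments ι (n + 2 + q) (n • (S - F * S * Fᵀ))
    (by positivity) (hV.smul hn)
  have hK' := fun A => hK (n + 2) F (n • (S - F * S * Fᵀ)) A
  simp_rw [← sliceDensity_eq] at hK'
  refine ⟨K * iwMass (n + 2 + q) (n • (S - F * S * Fᵀ)), mul_ne_zero h0 hm0,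
    ENNReal.mul_ne_top h1 hm1, fun A => (hK' A).1, fun A hA w => ?_⟩
  have h := (hK' A).2 0 w
  have hquad : ∀ p : (ι → ι → ℝ) × (Sym2 ι → ℝ), Sum.elim 0 w ⬝ᵥ
      (fromBlocks A (Matrix.of p.1)ᵀ (Matrix.of p.1) (symMat p.2)) *ᵥ Sum.elim 0 w =
      w ⬝ᵥ symMat p.2 *ᵥ w := by
    intro p
    simp [fromBlocks_mulVec, sumElim_dotProduct_sumElim]
  simp_rw [hquad] at h
  have hq0 : (0 : ℝ) ≤ q := by positivity
  rw [h, hm2 (by linarith) w]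
  have hdet : IsUnit S.det := (Matrix.isUnit_iff_isUnit_det _).1 hS.isUnit
  have hinv : (n • S)⁻¹ = n⁻¹ • S⁻¹ := by
    apply Matrix.inv_eq_right_inv
    rw [Matrix.smul_mul, Matrix.mul_smul, smul_smul, mul_inv_cancel₀ hn.ne', one_smul,
      Matrix.mul_nonsing_inv _ hdet]
  have htr := trace_mul_inv_nonneg hS hA
  have hVw := quadForm_nonneg hV w
  have h1' : 0 ≤ (Fᵀ *ᵥ w) ⬝ᵥ A *ᵥ (Fᵀ *ᵥ w) := quadForm_nonneg hA _
  have h2' : 0 ≤ w ⬝ᵥ (n • (S - F * S * Fᵀ)) *ᵥ w / (n + 2 + q - 2) := by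
    rw [Matrix.smul_mulVec, dotProduct_smul, smul_eq_mul]
    apply div_nonneg (by positivity); linarith
  have h3' : 0 ≤ 1 + (A * (n • S)⁻¹).trace := by
    rw [hinv, Matrix.mul_smul, Matrix.trace_smul, smul_eq_mul]; positivity
  have hfin : w ⬝ᵥ meanMap n S F A *ᵥ w = (Fᵀ *ᵥ w) ⬝ᵥ A *ᵥ (Fᵀ *ᵥ w) +
      (1 + (A * (n • S)⁻¹).trace) * (w ⬝ᵥ (n • (S - F * S * Fᵀ)) *ᵥ w / (n + 2 + q - 2)) := by
    rw [meanMap, Matrix.add_mulVec, dotProduct_add, hinv, Matrix.mul_smul, Matrix.trace_smul,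
      Matrix.smul_mulVec, Matrix.smul_mulVec, dotProduct_smul, dotProduct_smul, smul_eq_mul,
      smul_eq_mul, smul_eq_mul, ← Matrix.mulVec_mulVec, ← Matrix.mulVec_mulVec,
      Matrix.dotProduct_mulVec w F, ← Matrix.mulVec_transpose, cnq, ← hq]
    congr 1
    have : n + 2 + (q : ℝ) - 2 = n + q := by ring
    rw [this]
    field_simp
  rw [hfin, zero_add, ENNReal.ofReal_add h1' (mul_nonneg h3' h2'), ENNReal.ofReal_mul h3']
  ring

theorem sliceMass_ne (hn : 0 < n) (hS : S.PosDef) (hV : (S - F * S * Fᵀ).PosDef)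
    {A : Matrix ι ι ℝ} (hA : A.PosDef) :
    ∫⁻ p, sliceDensity n S F A p ≠ 0 ∧ ∫⁻ p, sliceDensity n S F A p ≠ ⊤ := by
  obtain ⟨K, h0, h1, hK, -⟩ := exists_sliceMass hn hS hV
  rw [hK]
  refine ⟨mul_ne_zero ?_ h0, ENNReal.mul_ne_top (iwDensity_ne_top _ _ _) h1⟩
  rw [iwDensity_of_posDef hA]
  have := hA.det_pos
  exact (ENNReal.ofReal_pos.2 (by positivity)).ne'

theorem sliceMass_mul_lintegral (hn : 0 < n) (hS : S.PosDef) (hV : (S - F * S * Fᵀ).PosDef)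
    (A : Matrix ι ι ℝ) {f : Matrix ι ι ℝ → ℝ≥0∞} (hf : Measurable f) :
    (∫⁻ p, sliceDensity n S F A p) * ∫⁻ M, f M ∂(transitionKernel n S F A) =
      ∫⁻ p, sliceDensity n S F A p * f (symMat p.2) := by
  rw [lintegral_transitionKernel A hf]
  by_cases hA : A.PosDef
  · obtain ⟨h0, h1⟩ := sliceMass_ne hn hS hV hA
    rw [← mul_assoc, ENNReal.mul_inv_cancel h0 h1, one_mul]
  · simp [sliceDensity_of_not_posDef hA]

theorem isProbabilityMeasure_transitionKernel (hn : 0 < n) (hS : S.PosDef)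
    (hV : (S - F * S * Fᵀ).PosDef) {A : Matrix ι ι ℝ} (hA : A.PosDef) :
    IsProbabilityMeasure (transitionKernel n S F A) := by
  obtain ⟨h0, h1⟩ := sliceMass_ne hn hS hV hA
  constructor
  have h := lintegral_transitionKernel (n := n) (S := S) (F := F) A
    (f := fun _ => 1) measurable_const
  simp only [lintegral_one, mul_one] at h
  rw [h, ENNReal.inv_mul_cancel h0 h1]

/-- Off the positive definite cone the slice density is zero, and normalization yields `⊤ * 0 = 0`.
The kernel is therefore finite but not Markov. -/
theorem transitionKernel_of_not_posDef {A : Matrix ι ι ℝ} (hA : ¬ A.PosDef) :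
    transitionKernel n S F A Set.univ = 0 := by
  have h := lintegral_transitionKernel (n := n) (S := S) (F := F) A
    (f := fun _ => 1) measurable_const
  simpa [sliceDensity_of_not_posDef hA] using h

theorem isFiniteKernel_transitionKernel (hn : 0 < n) (hS : S.PosDef)
    (hV : (S - F * S * Fᵀ).PosDef) : IsFiniteKernel (transitionKernel n S F) := by
  refine ⟨⟨1, ENNReal.one_lt_top, fun A => ?_⟩⟩
  by_cases hA : A.PosDef
  · have := isProbabilityMeasure_transitionKernel hn hS hV hA
    exact prob_le_one
  · rw [transitionKernel_of_not_posDef hA]; exact zero_le_one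

theorem ae_posDef_transitionKernel (A : Matrix ι ι ℝ) :
    ∀ᵐ M ∂(transitionKernel n S F A), M.PosDef := by
  have hs : MeasurableSet {M : Matrix ι ι ℝ | M.PosDef}ᶜ := measurableSet_posDef.compl
  rw [ae_iff]
  change transitionKernel n S F A {M : Matrix ι ι ℝ | M.PosDef}ᶜ = 0
  rw [← lintegral_indicator_one hs,
    lintegral_transitionKernel A (f := {M : Matrix ι ι ℝ | M.PosDef}ᶜ.indicator 1)
      (measurable_one.indicator hs)]
  have : ∀ p : (ι → ι → ℝ) × (Sym2 ι → ℝ), sliceDensity n S F A p *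
      ({M : Matrix ι ι ℝ | M.PosDef}ᶜ.indicator 1 (symMat p.2) : ℝ≥0∞) = 0 := by
    intro p
    by_cases hp : (symMat p.2).PosDef
    · rw [Set.indicator_of_notMem (by simpa using hp), mul_zero]
    · rw [sliceDensity, iwDensity_of_not_posDef, zero_mul]
      exact fun h => hp (h.submatrix Sum.inr_injective)
  simp [this]

theorem lintegral_quadForm_transitionKernel (hn : 0 < n) (hS : S.PosDef)
    (hV : (S - F * S * Fᵀ).PosDef) {A : Matrix ι ι ℝ} (hA : A.PosDef) (w : ι → ℝ) :
    ∫⁻ M, ENNReal.ofReal (w ⬝ᵥ M *ᵥ w) ∂(transitionKernel n S F A) =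
      ENNReal.ofReal (w ⬝ᵥ meanMap n S F A *ᵥ w) := by
  obtain ⟨h0, h1⟩ := sliceMass_ne hn hS hV hA
  obtain ⟨K, -, -, hK, hK2⟩ := exists_sliceMass hn hS hV
  rw [lintegral_transitionKernel A (f := fun M => ENNReal.ofReal (w ⬝ᵥ M *ᵥ w))
      (measurable_quadForm measurable_id w).ennreal_ofReal,
    hK2 A hA, ← hK, ← mul_assoc, ENNReal.inv_mul_cancel h0 h1, one_mul]

theorem integral_entry_transitionKernel (hn : 0 < n) (hS : S.PosDef)
    (hV : (S - F * S * Fᵀ).PosDef) {A : Matrix ι ι ℝ} (hA : A.PosDef) (i j : ι) :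
    ∫ M, M i j ∂(transitionKernel n S F A) = meanMap n S F A i j :=
  integral_entry (ae_posDef_transitionKernel A) (posDef_meanMap hn hS hV hA)
    (lintegral_quadForm_transitionKernel hn hS hV hA) i j

theorem lintegral_inverseWishart (δ : ℝ) (D : Matrix ι ι ℝ) {f : Matrix ι ι ℝ → ℝ≥0∞}
    (hf : Measurable f) :
    ∫⁻ M, f M ∂(inverseWishart δ D) =
      (iwMass δ D)⁻¹ * ∫⁻ x : Sym2 ι → ℝ, iwDensity δ D (symMat x) * f (symMat x) := by
  have hd : Measurable fun x : Sym2 ι → ℝ => iwDensity δ D (symMat x) :=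
    (measurable_iwDensity _ _).comp measurable_symMat
  rw [inverseWishart, lintegral_map hf measurable_symMat, normalize, lintegral_smul_measure,
    lintegral_withDensity_eq_lintegral_mul _ hd (g := fun x => f (symMat x))
      (hf.comp measurable_symMat),
    withDensity_apply _ MeasurableSet.univ, Measure.restrict_univ]
  rfl

theorem ae_posDef_inverseWishart (δ : ℝ) (D : Matrix ι ι ℝ) :
    ∀ᵐ M ∂(inverseWishart δ D), M.PosDef := by
  have hs : MeasurableSet {M : Matrix ι ι ℝ | M.PosDef}ᶜ := measurableSet_posDef.compl
  rw [ae_iff]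
  change inverseWishart δ D {M : Matrix ι ι ℝ | M.PosDef}ᶜ = 0
  rw [← lintegral_indicator_one hs,
    lintegral_inverseWishart δ D (f := {M : Matrix ι ι ℝ | M.PosDef}ᶜ.indicator 1)
      (measurable_one.indicator hs)]
  have : ∀ x : Sym2 ι → ℝ, iwDensity δ D (symMat x) *
      ({M : Matrix ι ι ℝ | M.PosDef}ᶜ.indicator 1 (symMat x) : ℝ≥0∞) = 0 := by
    intro x
    by_cases hx : (symMat x).PosDef
    · rw [Set.indicator_of_notMem (by simpa using hx), mul_zero]
    · rw [iwDensity_of_not_posDef hx, zero_mul]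
  simp [this]

theorem lintegral_quadForm_inverseWishart {δ : ℝ} (hδ : 2 < δ) {D : Matrix ι ι ℝ} (hD : D.PosDef)
    (v : ι → ℝ) : ∫⁻ M, ENNReal.ofReal (v ⬝ᵥ M *ᵥ v) ∂(inverseWishart δ D) =
      ENNReal.ofReal (v ⬝ᵥ D *ᵥ v / (δ - 2)) := by
  obtain ⟨h0, h1, h2⟩ := hasIWMoments ι δ D (by linarith) hD
  rw [lintegral_inverseWishart δ D (f := fun M => ENNReal.ofReal (v ⬝ᵥ M *ᵥ v))
    (measurable_quadForm measurable_id v).ennreal_ofReal]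
  change _ * iwQuad δ D v = _
  rw [h2 hδ, mul_comm, mul_assoc, ENNReal.mul_inv_cancel h0 h1, mul_one]

theorem measurable_toBlocks₁₁ {κ : Type*} :
    Measurable (toBlocks₁₁ : Matrix (ι ⊕ κ) (ι ⊕ κ) ℝ → Matrix ι ι ℝ) :=
  measurable_matrix fun i j => measurable_entry (Sum.inl i) (Sum.inl j)

theorem measurable_toBlocks₂₂ {κ : Type*} :
    Measurable (toBlocks₂₂ : Matrix (κ ⊕ ι) (κ ⊕ ι) ℝ → Matrix ι ι ℝ) :=
  measurable_matrix fun i j => measurable_entry (Sum.inr i) (Sum.inr j)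

/-- The conditional law of the second diagonal block given the first is the transition law. -/
theorem lintegral_inverseWishart_blocks (hn : 0 < n) (hS : S.PosDef)
    (hV : (S - F * S * Fᵀ).PosDef) {g : Matrix ι ι ℝ × Matrix ι ι ℝ → ℝ≥0∞} (hg : Measurable g) :
    ∫⁻ M, g (M.toBlocks₁₁, M.toBlocks₂₂) ∂(inverseWishart (n + 2) (augScale n S F)) =
      ∫⁻ M, ∫⁻ C, g (M.toBlocks₁₁, C) ∂(transitionKernel n S F M.toBlocks₁₁)
        ∂(inverseWishart (n + 2) (augScale n S F)) := by
  have := isFiniteKernel_transitionKernel hn hS hV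
  have hG : Measurable fun A => ∫⁻ C, g (A, C) ∂(transitionKernel n S F A) :=
    hg.lintegral_kernel_prod_right'
  rw [lintegral_inverseWishart _ _ (f := fun M => g (M.toBlocks₁₁, M.toBlocks₂₂))
      (hg.comp (measurable_toBlocks₁₁.prodMk measurable_toBlocks₂₂)),
    lintegral_inverseWishart _ _ (f := fun M =>
      ∫⁻ C, g (M.toBlocks₁₁, C) ∂(transitionKernel n S F M.toBlocks₁₁))
      (hG.comp measurable_toBlocks₁₁)]
  congr 1
  rw [lintegral_symMat_sum (f := fun M => iwDensity (n + 2) (augScale n S F) M *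
      g (M.toBlocks₁₁, M.toBlocks₂₂)) ((measurable_iwDensity _ _).mul
      (hg.comp (measurable_toBlocks₁₁.prodMk measurable_toBlocks₂₂))),
    lintegral_symMat_sum (f := fun M => iwDensity (n + 2) (augScale n S F) M *
      ∫⁻ C, g (M.toBlocks₁₁, C) ∂(transitionKernel n S F M.toBlocks₁₁))
      ((measurable_iwDensity _ _).mul (hG.comp measurable_toBlocks₁₁))]
  refine lintegral_congr fun x => ?_
  simp only [toBlocks_fromBlocks₁₁, toBlocks_fromBlocks₂₂]
  change ∫⁻ p, sliceDensity n S F (symMat x) p * g (symMat x, symMat p.2) =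
    ∫⁻ p, sliceDensity n S F (symMat x) p * _
  -- With the first block fixed, the inner integral is a constant, and the slice mass cancels the
  -- normalization of the kernel.
  rw [lintegral_mul_const _ (measurable_sliceDensity_right n S F _),
    sliceMass_mul_lintegral hn hS hV (symMat x) (f := fun C => g (symMat x, C))
      (hg.comp measurable_prodMk_left)]

end Transition

end IWAR

namespace IWAR

/-! ### Propagation of means along the chain, and conditional expectations for the process. -/

section Chain

variable {ι : Type*} [Fintype ι] [DecidableEq ι] {n : ℝ} {S F : Matrix ι ι ℝ}

theorem meanMap_affine (n : ℝ) (S F : Matrix ι ι ℝ) (i j : ι) :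
    ∃ (b : ℝ) (c : ι → ι → ℝ), ∀ M, meanMap n S F M i j = b + ∑ k, ∑ l, c k l * M k l := by
  set V := S - F * S * Fᵀ with hV
  set a := cnq n (Fintype.card ι) with ha
  refine ⟨a * V i j, fun k l => F i k * F j l + a * n⁻¹ * V i j * S⁻¹ l k, fun M => ?_⟩
  rw [meanMap, ← hV, ← ha, Matrix.add_apply, Matrix.smul_apply, smul_eq_mul]
  have h1 : (F * M * Fᵀ) i j = ∑ k, ∑ l, F i k * F j l * M k l := by
    simp only [Matrix.mul_apply, Matrix.transpose_apply, Finset.sum_mul]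
    rw [Finset.sum_comm]
    refine Finset.sum_congr rfl fun _ _ => Finset.sum_congr rfl fun _ _ => ?_
    ring
  have h2 : (M * S⁻¹).trace = ∑ k, ∑ l, S⁻¹ l k * M k l := by
    simp only [Matrix.trace, Matrix.diag_apply, Matrix.mul_apply]
    refine Finset.sum_congr rfl fun _ _ => Finset.sum_congr rfl fun _ _ => ?_
    ring
  have h3 : a * n⁻¹ * V i j * ∑ k, ∑ l, S⁻¹ l k * M k l =
      ∑ k, ∑ l, a * n⁻¹ * V i j * S⁻¹ l k * M k l := by
    simp only [Finset.mul_sum, mul_assoc]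
  simp only [add_mul, Finset.sum_add_distrib]
  rw [h1, h2, ← h3]
  ring

theorem measurable_meanMap : Measurable (meanMap n S F) := by
  refine measurable_matrix fun i j => ?_
  obtain ⟨b, c, h⟩ := meanMap_affine n S F i j
  simp_rw [h]
  exact (Finset.measurable_sum _ fun k _ => Finset.measurable_sum _ fun l _ =>
    (measurable_entry k l).const_mul _).const_add _

variable {Ω : Type*} [MeasurableSpace Ω]

theorem integrable_meanMap {μ : Measure Ω} [IsFiniteMeasure μ] {X : Ω → Matrix ι ι ℝ}
    (hX : ∀ i j, Integrable (fun ω => X ω i j) μ) (i j : ι) :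
    Integrable (fun ω => meanMap n S F (X ω) i j) μ := by
  obtain ⟨b, c, h⟩ := meanMap_affine n S F i j
  simp_rw [h]
  exact (integrable_const b).add (integrable_finsetSum _ fun k _ => integrable_finsetSum _ fun l _ =>
    (hX k l).const_mul _)

/-- The coefficients are chosen before the measure and the random matrix, so that different ones can
be compared. The total mass multiplies the constant term because restrictions of `P` to events will
be used. -/
theorem exists_integral_meanMap (n : ℝ) (S F : Matrix ι ι ℝ) (i j : ι) :
    ∃ (b : ℝ) (c : ι → ι → ℝ), (∀ M, meanMap n S F M i j = b + ∑ k, ∑ l, c k l * M k l) ∧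
      ∀ {Ω : Type _} [MeasurableSpace Ω] (μ : Measure Ω) [IsFiniteMeasure μ]
        (X : Ω → Matrix ι ι ℝ), (∀ i j, Integrable (fun ω => X ω i j) μ) →
        ∫ ω, meanMap n S F (X ω) i j ∂μ =
          μ.real Set.univ * b + ∑ k, ∑ l, c k l * ∫ ω, X ω k l ∂μ := by
  obtain ⟨b, c, h⟩ := meanMap_affine n S F i j
  refine ⟨b, c, h, fun μ _ X hX => ?_⟩
  simp_rw [h]
  rw [integral_add (integrable_const b) (integrable_finsetSum _ fun k _ =>
    integrable_finsetSum _ fun l _ => (hX k l).const_mul _), integral_const, smul_eq_mul,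
    integral_finsetSum _ fun k _ => integrable_finsetSum _ fun l _ => (hX k l).const_mul _]
  congr 1
  refine Finset.sum_congr rfl fun k _ => ?_
  rw [integral_finsetSum _ fun l _ => (hX k l).const_mul _]
  simp_rw [integral_const_mul]

theorem integral_meanMap {μ : Measure Ω} [IsProbabilityMeasure μ] {X : Ω → Matrix ι ι ℝ}
    (hX : ∀ i j, Integrable (fun ω => X ω i j) μ) {L : Matrix ι ι ℝ}
    (hL : ∀ i j, ∫ ω, X ω i j ∂μ = L i j) (i j : ι) :
    ∫ ω, meanMap n S F (X ω) i j ∂μ = meanMap n S F L i j := by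
  obtain ⟨b, c, h, h2⟩ := exists_integral_meanMap n S F i j
  rw [h2 μ X hX, h]
  simp [hL]

theorem integral_meanMap_congr {μ : Measure Ω} [IsFiniteMeasure μ] {X Y : Ω → Matrix ι ι ℝ}
    (hX : ∀ i j, Integrable (fun ω => X ω i j) μ) (hY : ∀ i j, Integrable (fun ω => Y ω i j) μ)
    (h : ∀ i j, ∫ ω, X ω i j ∂μ = ∫ ω, Y ω i j ∂μ) (i j : ι) :
    ∫ ω, meanMap n S F (X ω) i j ∂μ = ∫ ω, meanMap n S F (Y ω) i j ∂μ := by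
  obtain ⟨b, c, -, h2⟩ := exists_integral_meanMap n S F i j
  rw [h2 μ X hX, h2 μ Y hY]
  simp [h]

theorem posDef_iterate_meanMap (hn : 0 < n) (hS : S.PosDef) (hV : (S - F * S * Fᵀ).PosDef)
    {A : Matrix ι ι ℝ} (hA : A.PosDef) (t : ℕ) : ((meanMap n S F)^[t] A).PosDef := by
  induction t with
  | zero => exact hA
  | succ t ih =>
    rw [Function.iterate_succ_apply']
    exact posDef_meanMap hn hS hV ih

/-- The four claims support one another in the induction: the kernel has mass one and mean `meanMap`
only on positive definite states, and the affine `meanMap` passes through the expectation only for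
an integrable state under a probability measure. -/
theorem condLaw_moments (hn : 0 < n) (hS : S.PosDef) (hV : (S - F * S * Fᵀ).PosDef)
    {A : Matrix ι ι ℝ} (hA : A.PosDef) (t : ℕ) :
    IsProbabilityMeasure (condLaw n S F A t) ∧ (∀ᵐ M ∂(condLaw n S F A t), M.PosDef) ∧
      (∀ i j, Integrable (fun M : Matrix ι ι ℝ => M i j) (condLaw n S F A t)) ∧
      ∀ i j, ∫ M, M i j ∂(condLaw n S F A t) = (meanMap n S F)^[t] A i j := by
  induction t with
  | zero =>
    refine ⟨by rw [condLaw]; infer_instance, ?_, fun i j => ?_, fun i j => ?_⟩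
    · rw [condLaw, ae_dirac_iff measurableSet_posDef]
      exact hA
    · rw [condLaw]
      refine ⟨(measurable_entry i j).aestronglyMeasurable, ?_⟩
      rw [HasFiniteIntegral, lintegral_dirac' _ (measurable_entry i j).enorm]
      exact enorm_lt_top
    · rw [condLaw, integral_dirac' _ _ (measurable_entry i j).stronglyMeasurable]
      rfl
  | succ t ih =>
    obtain ⟨h1, h2, h3, h4⟩ := ih
    have hk : AEMeasurable (transitionKernel n S F) (condLaw n S F A t) :=
      (transitionKernel n S F).measurable.aemeasurable
    have hpd : ∀ᵐ M ∂(condLaw n S F A (t + 1)), M.PosDef := by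
      rw [ae_iff]
      change condLaw n S F A (t + 1) {M : Matrix ι ι ℝ | M.PosDef}ᶜ = 0
      rw [condLaw, Measure.bind_apply measurableSet_posDef.compl hk]
      have : ∀ M, transitionKernel n S F M {M : Matrix ι ι ℝ | M.PosDef}ᶜ = 0 := fun M =>
        ae_iff.1 (ae_posDef_transitionKernel M)
      simp [this]
    have hq : ∀ v, ∫⁻ M, ENNReal.ofReal (v ⬝ᵥ M *ᵥ v) ∂(condLaw n S F A (t + 1)) =
        ENNReal.ofReal (v ⬝ᵥ (meanMap n S F)^[t + 1] A *ᵥ v) := by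
      intro v
      have hmi : ∀ i j, Integrable (fun M => meanMap n S F M i j) (condLaw n S F A t) :=
        integrable_meanMap h3
      have hsum : ∀ N : Matrix ι ι ℝ, v ⬝ᵥ N *ᵥ v = ∑ i, ∑ j, v i * (N i j * v j) := by
        intro N; simp [dotProduct, Matrix.mulVec, Finset.mul_sum]
      rw [condLaw, Measure.lintegral_bind (f := fun M => ENNReal.ofReal (v ⬝ᵥ M *ᵥ v)) hk
        (measurable_quadForm measurable_id v).ennreal_ofReal.aemeasurable]
      have e1 : ∫⁻ M, ∫⁻ C, ENNReal.ofReal (v ⬝ᵥ C *ᵥ v) ∂(transitionKernel n S F M)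
          ∂(condLaw n S F A t) =
          ∫⁻ M, ENNReal.ofReal (v ⬝ᵥ meanMap n S F M *ᵥ v) ∂(condLaw n S F A t) := by
        refine lintegral_congr_ae ?_
        filter_upwards [h2] with M hM
        exact lintegral_quadForm_transitionKernel hn hS hV hM v
      refine e1.trans ?_
      rw [← ofReal_integral_eq_lintegral_ofReal]
      · congr 1
        simp_rw [hsum]
        rw [integral_finsetSum _ fun i _ => integrable_finsetSum _ fun j _ =>
          ((hmi i j).mul_const _).const_mul _]
        refine Finset.sum_congr rfl fun i _ => ?_
        rw [integral_finsetSum _ fun j _ => ((hmi i j).mul_const _).const_mul _]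
        refine Finset.sum_congr rfl fun j _ => ?_
        rw [integral_const_mul, integral_mul_const, integral_meanMap h3 h4,
          Function.iterate_succ_apply']
      · simp_rw [hsum]
        exact integrable_finsetSum _ fun i _ => integrable_finsetSum _ fun j _ =>
          ((hmi i j).mul_const _).const_mul _
      · filter_upwards [h2] with M hM using quadForm_nonneg (posDef_meanMap hn hS hV hM) v
    refine ⟨⟨?_⟩, hpd, integrable_entry measurable_id hpd fun v =>
      (hq v).trans_ne ENNReal.ofReal_ne_top,
      integral_entry hpd (posDef_iterate_meanMap hn hS hV hA _) hq⟩
    rw [condLaw, Measure.bind_apply MeasurableSet.univ hk]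
    have : ∫⁻ M, transitionKernel n S F M Set.univ ∂(condLaw n S F A t) =
        ∫⁻ _, 1 ∂(condLaw n S F A t) := by
      refine lintegral_congr_ae ?_
      filter_upwards [h2] with M hM
      have := isProbabilityMeasure_transitionKernel hn hS hV hM
      exact measure_univ
    rw [this, lintegral_one, measure_univ]

theorem condMean_eq_iterate (hn : 0 < n) (hS : S.PosDef) (hV : (S - F * S * Fᵀ).PosDef)
    {A : Matrix ι ι ℝ} (hA : A.PosDef) (t : ℕ) :
    condMean n S F t A = (meanMap n S F)^[t] A := by
  ext i j
  exact (condLaw_moments hn hS hV hA t).2.2.2 i j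

variable {P : Measure Ω} [IsProbabilityMeasure P] {X : ℕ → Ω → Matrix ι ι ℝ}

theorem IsIWAR.lintegral_pair (h : IsIWAR n S F P X) (t : ℕ)
    {g : Matrix ι ι ℝ × Matrix ι ι ℝ → ℝ≥0∞} (hg : Measurable g) :
    ∫⁻ ω, g (X t ω, X (t + 1) ω) ∂P =
      ∫⁻ M, g (M.toBlocks₁₁, M.toBlocks₂₂) ∂(inverseWishart (n + 2) (augScale n S F)) := by
  have h1 : Measurable fun ω => (X t ω, X (t + 1) ω) := (h.measurable t).prodMk (h.measurable _)
  have h2 : Measurable fun M : Matrix (ι ⊕ ι) (ι ⊕ ι) ℝ => (M.toBlocks₁₁, M.toBlocks₂₂) :=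
    measurable_toBlocks₁₁.prodMk measurable_toBlocks₂₂
  rw [← lintegral_map hg h1, h.pair_law t, lintegral_map hg h2]

theorem IsIWAR.lintegral_next (h : IsIWAR n S F P X) (hn : 0 < n) (hS : S.PosDef)
    (hV : (S - F * S * Fᵀ).PosDef) (t : ℕ) {g : Matrix ι ι ℝ × Matrix ι ι ℝ → ℝ≥0∞}
    (hg : Measurable g) :
    ∫⁻ ω, g (X t ω, X (t + 1) ω) ∂P =
      ∫⁻ ω, ∫⁻ C, g (X t ω, C) ∂(transitionKernel n S F (X t ω)) ∂P := by
  have := isFiniteKernel_transitionKernel hn hS hV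
  have hG : Measurable fun A => ∫⁻ C, g (A, C) ∂(transitionKernel n S F A) :=
    hg.lintegral_kernel_prod_right'
  rw [h.lintegral_pair t hg, lintegral_inverseWishart_blocks hn hS hV hg,
    h.lintegral_pair t (g := fun p => ∫⁻ C, g (p.1, C) ∂(transitionKernel n S F p.1))
      (hG.comp measurable_fst)]

theorem IsIWAR.ae_posDef (h : IsIWAR n S F P X) (t : ℕ) : ∀ᵐ ω ∂P, (X t ω).PosDef := by
  have hs : MeasurableSet {M : Matrix ι ι ℝ | M.PosDef}ᶜ := measurableSet_posDef.compl
  have h1 := h.lintegral_pair t (g := fun p => {M : Matrix ι ι ℝ | M.PosDef}ᶜ.indicator 1 p.1)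
    ((measurable_one.indicator hs).comp measurable_fst)
  have h2 : ∫⁻ M, {M : Matrix ι ι ℝ | M.PosDef}ᶜ.indicator (1 : Matrix ι ι ℝ → ℝ≥0∞) M.toBlocks₁₁
      ∂(inverseWishart (n + 2) (augScale n S F)) = 0 := by
    rw [lintegral_eq_zero_iff (f := fun M : Matrix (ι ⊕ ι) (ι ⊕ ι) ℝ =>
      {M : Matrix ι ι ℝ | M.PosDef}ᶜ.indicator (1 : Matrix ι ι ℝ → ℝ≥0∞) M.toBlocks₁₁)
      ((measurable_one.indicator hs).comp measurable_toBlocks₁₁)]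
    filter_upwards [ae_posDef_inverseWishart (n + 2) (augScale n S F)] with M hM
    have : M.toBlocks₁₁.PosDef := hM.submatrix Sum.inl_injective
    simp [this]
  simp only at h1
  rw [h2, lintegral_eq_zero_iff (f := fun ω =>
    {M : Matrix ι ι ℝ | M.PosDef}ᶜ.indicator (1 : Matrix ι ι ℝ → ℝ≥0∞) (X t ω))
    ((measurable_one.indicator hs).comp (h.measurable t))] at h1
  filter_upwards [h1] with ω hω
  by_contra hc
  simp [hc] at hω

theorem IsIWAR.integrable_entry (h : IsIWAR n S F P X) (hn : 0 < n) (hS : S.PosDef)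
    (hV : (S - F * S * Fᵀ).PosDef) (t : ℕ) (i j : ι) : Integrable (fun ω => X t ω i j) P := by
  refine IWAR.integrable_entry (h.measurable t) (h.ae_posDef t) (fun v => ?_) i j
  have h1 := h.lintegral_pair t (g := fun p => ENNReal.ofReal (v ⬝ᵥ p.1 *ᵥ v))
    (measurable_quadForm measurable_fst v).ennreal_ofReal
  have h2 := lintegral_quadForm_inverseWishart (δ := n + 2) (by linarith)
    (posDef_augScale hn hS hV) (Sum.elim v 0)
  have h3 : ∀ M : Matrix (ι ⊕ ι) (ι ⊕ ι) ℝ,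
      Sum.elim v 0 ⬝ᵥ M *ᵥ Sum.elim v 0 = v ⬝ᵥ M.toBlocks₁₁ *ᵥ v := by
    intro M
    conv_lhs => rw [← fromBlocks_toBlocks M]
    simp [fromBlocks_mulVec, sumElim_dotProduct_sumElim]
  simp_rw [h3] at h2
  simp only at h1
  rw [h1, h2]
  exact ENNReal.ofReal_ne_top

/-- The disintegration of the pair law, tested on rectangles `A ×ˢ B`, is the defining property of
the conditional expectation given `X t`. -/
theorem IsIWAR.condExp_indicator (h : IsIWAR n S F P X) (hn : 0 < n) (hS : S.PosDef)
    (hV : (S - F * S * Fᵀ).PosDef) (t : ℕ) {B : Set (Matrix ι ι ℝ)} (hB : MeasurableSet B) :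
    (fun ω => (transitionKernel n S F (X t ω) B).toReal) =ᵐ[P]
      P[(X (t + 1) ⁻¹' B).indicator (fun _ => (1 : ℝ)) |
        MeasurableSpace.comap (X t) inferInstance] := by
  have := isFiniteKernel_transitionKernel hn hS hV
  have hm := (h.measurable t).comap_le
  have hk : Measurable fun A => transitionKernel n S F A B := Kernel.measurable_coe _ hB
  have hkX : Measurable fun ω => transitionKernel n S F (X t ω) B := hk.comp (h.measurable t)
  have hkb : ∀ ω, (transitionKernel n S F (X t ω) B).toReal ≤
      (transitionKernel n S F).bound.toReal := fun ω =>
    ENNReal.toReal_mono (transitionKernel n S F).bound_ne_top (Kernel.measure_le_bound _ _ _)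
  have hki : Integrable (fun ω => (transitionKernel n S F (X t ω) B).toReal) P :=
    Integrable.of_bound hkX.ennreal_toReal.aestronglyMeasurable _ <| ae_of_all _ fun ω => by
      rw [Real.norm_of_nonneg ENNReal.toReal_nonneg]; exact hkb ω
  have hBm : MeasurableSet (X (t + 1) ⁻¹' B) := h.measurable _ hB
  refine ae_eq_condExp_of_forall_setIntegral_eq hm ((integrable_const 1).indicator hBm)
    (fun s _ _ => hki.integrableOn) ?_ ?_
  · rintro _ ⟨A, hA, rfl⟩ -
    have hAm : MeasurableSet (X t ⁻¹' A) := h.measurable _ hA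
    have h1 := h.lintegral_next hn hS hV t
      (g := (A ×ˢ B).indicator 1) (measurable_one.indicator (hA.prod hB))
    have h2 : ∀ ω, ∫⁻ C, (A ×ˢ B).indicator (1 : Matrix ι ι ℝ × Matrix ι ι ℝ → ℝ≥0∞) (X t ω, C)
        ∂(transitionKernel n S F (X t ω)) =
        (X t ⁻¹' A).indicator (fun ω => transitionKernel n S F (X t ω) B) ω := by
      intro ω
      by_cases hω : X t ω ∈ A
      · rw [Set.indicator_of_mem (by exact hω), ← lintegral_indicator_one hB]
        refine lintegral_congr fun C => ?_
        by_cases hC : C ∈ B <;> simp [hω, hC]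
      · rw [Set.indicator_of_notMem (by exact hω)]
        simp [hω]
    have h3 : ∀ ω, (A ×ˢ B).indicator (1 : Matrix ι ι ℝ × Matrix ι ι ℝ → ℝ≥0∞)
        (X t ω, X (t + 1) ω) =
        (X t ⁻¹' A ∩ X (t + 1) ⁻¹' B).indicator 1 ω := by
      intro ω
      by_cases h4 : X t ω ∈ A <;> by_cases h5 : X (t + 1) ω ∈ B <;> simp [h4, h5]
    rw [lintegral_congr h2, lintegral_congr h3] at h1
    rw [lintegral_indicator_one (hAm.inter hBm), lintegral_indicator hAm] at h1
    rw [integral_indicator hBm, Measure.restrict_restrict hBm, setIntegral_const,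
      integral_toReal hkX.aemeasurable]
    · rw [← h1, Set.inter_comm]; simp [Measure.real]
    · exact ae_of_all _ fun ω => measure_lt_top _ _
  · exact (Measurable.stronglyMeasurable
      (hk.ennreal_toReal.comp (comap_measurable (X t)))).aestronglyMeasurable

/-- The Markov property upgrades conditioning on `X t` to conditioning on the whole past, so the
one-step identity survives restriction to any past event. -/
theorem IsIWAR.map_restrict_next (h : IsIWAR n S F P X) (hn : 0 < n) (hS : S.PosDef)
    (hV : (S - F * S * Fᵀ).PosDef) (t : ℕ) {G : Set Ω}
    (hG : MeasurableSet[⨆ s ∈ Set.Iic t, MeasurableSpace.comap (X s) inferInstance] G) :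
    (P.restrict G).map (X (t + 1)) = ((P.restrict G).map (X t)).bind (transitionKernel n S F) := by
  have := isFiniteKernel_transitionKernel hn hS hV
  have hle : (⨆ s ∈ Set.Iic t, MeasurableSpace.comap (X s) inferInstance) ≤
      (inferInstance : MeasurableSpace Ω) := iSup₂_le fun s _ => (h.measurable s).comap_le
  ext B hB
  have hBm : MeasurableSet (X (t + 1) ⁻¹' B) := h.measurable _ hB
  have hkX : Measurable fun ω => transitionKernel n S F (X t ω) B :=
    (Kernel.measurable_coe _ hB).comp (h.measurable t)
  rw [Measure.map_apply (h.measurable _) hB, Measure.bind_apply hB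
    (transitionKernel n S F).measurable.aemeasurable,
    lintegral_map (Kernel.measurable_coe _ hB) (h.measurable t), Measure.restrict_apply hBm]
  have h1 := (h.condExp_indicator hn hS hV t hB).trans (h.markov t B hB).symm
  have h2 := setIntegral_condExp hle
    ((integrable_const (μ := P) (1 : ℝ)).indicator hBm) hG
  rw [← setIntegral_congr_ae (hle _ hG) (h1.mono fun ω hω _ => hω), integral_indicator hBm,
    Measure.restrict_restrict hBm, setIntegral_const,
    integral_toReal hkX.aemeasurable (ae_of_all _ fun ω => measure_lt_top _ _)] at h2
  have h3 : ∫⁻ ω in G, transitionKernel n S F (X t ω) B ∂P ≠ ⊤ := by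
    refine ((lintegral_mono fun ω => Kernel.measure_le_bound _ _ _).trans_lt ?_).ne
    rw [lintegral_const]
    exact ENNReal.mul_lt_top (Kernel.bound_lt_top _) (measure_lt_top _ _)
  rw [smul_eq_mul, mul_one, Measure.real, ENNReal.toReal_eq_toReal_iff' h3 (measure_ne_top _ _)]
    at h2
  exact h2.symm

theorem IsIWAR.setIntegral_next (h : IsIWAR n S F P X) (hn : 0 < n) (hS : S.PosDef)
    (hV : (S - F * S * Fᵀ).PosDef) (t : ℕ) {G : Set Ω}
    (hG : MeasurableSet[⨆ s ∈ Set.Iic t, MeasurableSpace.comap (X s) inferInstance] G)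
    (i j : ι) :
    ∫ ω in G, X (t + 1) ω i j ∂P = ∫ ω in G, meanMap n S F (X t ω) i j ∂P := by
  have hpd : ∀ᵐ A ∂((P.restrict G).map (X t)), A.PosDef := by
    rw [ae_map_iff (h.measurable t).aemeasurable measurableSet_posDef]
    exact ae_restrict_of_ae (h.ae_posDef t)
  have hmap := h.map_restrict_next hn hS hV t hG
  have hint : Integrable (fun M : Matrix ι ι ℝ => M i j) ((P.restrict G).map (X (t + 1))) := by
    rw [integrable_map_measure (measurable_entry i j).aestronglyMeasurable
      (h.measurable _).aemeasurable]
    exact (h.integrable_entry hn hS hV (t + 1) i j).integrableOn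
  rw [← integral_map (f := fun M : Matrix ι ι ℝ => M i j) (h.measurable (t + 1)).aemeasurable
    (measurable_entry i j).aestronglyMeasurable]
  -- The measure is recast as a composition with a constant kernel in order to apply
  -- `Kernel.integral_comp`.
  have hc : ((P.restrict G).map (X t)).bind (transitionKernel n S F) =
      (transitionKernel n S F ∘ₖ Kernel.const Unit ((P.restrict G).map (X t))) () := by
    rw [Kernel.comp_apply, Kernel.const_apply]
  rw [hmap, hc] at hint ⊢
  rw [Kernel.integral_comp hint, Kernel.const_apply,
    integral_congr_ae (hpd.mono fun A hA => integral_entry_transitionKernel hn hS hV hA i j),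
    integral_map (h.measurable t).aemeasurable]
  exact ((measurable_entry i j).comp measurable_meanMap).aestronglyMeasurable

/-- The tower property in integrated form: an event of the initial state belongs to the past at
every time, and equality of the means of two random matrices over it is preserved by the affine
`meanMap`. -/
theorem IsIWAR.setIntegral_iterate (h : IsIWAR n S F P X) (hn : 0 < n) (hS : S.PosDef)
    (hV : (S - F * S * Fᵀ).PosDef) {G : Set Ω}
    (hG : MeasurableSet[MeasurableSpace.comap (X 0) inferInstance] G) (t : ℕ) :
    (∀ i j, Integrable (fun ω => (meanMap n S F)^[t] (X 0 ω) i j) P) ∧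
    ∀ i j, ∫ ω in G, X t ω i j ∂P = ∫ ω in G, (meanMap n S F)^[t] (X 0 ω) i j ∂P := by
  induction t with
  | zero => exact ⟨h.integrable_entry hn hS hV 0, fun i j => rfl⟩
  | succ t ih =>
    have hle : MeasurableSpace.comap (X 0) inferInstance ≤
        (⨆ s ∈ Set.Iic t, MeasurableSpace.comap (X s) inferInstance) :=
      le_iSup₂_of_le 0 (Set.mem_Iic.2 t.zero_le) le_rfl
    simp_rw [Function.iterate_succ_apply']
    refine ⟨integrable_meanMap ih.1, fun i j => ?_⟩
    rw [h.setIntegral_next hn hS hV t (hle _ hG)]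
    exact integral_meanMap_congr (fun i j => (h.integrable_entry hn hS hV t i j).integrableOn)
      (fun i j => (ih.1 i j).integrableOn) ih.2 i j

theorem IsIWAR.condExp_entry (h : IsIWAR n S F P X) (hn : 0 < n) (hS : S.PosDef)
    (hV : (S - F * S * Fᵀ).PosDef) (t : ℕ) (i j : ι) :
    P[fun ω => X t ω i j | MeasurableSpace.comap (X 0) inferInstance] =ᵐ[P]
      fun ω => condMean n S F t (X 0 ω) i j := by
  have hm := (h.measurable 0).comap_le
  have h1 : (fun ω => (meanMap n S F)^[t] (X 0 ω) i j) =ᵐ[P]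
      P[fun ω => X t ω i j | MeasurableSpace.comap (X 0) inferInstance] := by
    refine ae_eq_condExp_of_forall_setIntegral_eq hm (h.integrable_entry hn hS hV t i j)
      (fun s _ _ => ?_) (fun s hs _ => ?_) ?_
    -- The integrability claim does not involve `G`, so any event serves.
    · exact ((h.setIntegral_iterate hn hS hV (G := ∅)
        (@MeasurableSet.empty _ (MeasurableSpace.comap (X 0) inferInstance)) t).1 i j).integrableOn
    · exact ((h.setIntegral_iterate hn hS hV hs t).2 i j).symm
    · exact (Measurable.stronglyMeasurable ((measurable_entry i j).comp
        ((measurable_meanMap.iterate t).comp (comap_measurable (X 0))))).aestronglyMeasurable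
  filter_upwards [h1, h.ae_posDef 0] with ω h2 h3
  rw [← h2, condMean_eq_iterate hn hS hV h3]

end Chain

end IWAR

namespace IWAR

/-! ### The affine recursion on eigenvalues and its limit. -/

section Dynamics

variable {q : ℕ} {n : ℝ} {ρ ξ : Fin q → ℝ}

theorem alphaVec_apply (n : ℝ) (ρ ξ : Fin q → ℝ) (i : Fin q) :
    alphaVec n ρ ξ i = cnq n q * ((1 - ρ i ^ 2) * ξ i) := by
  have : (1 : Matrix (Fin q) (Fin q) ℝ) - Matrix.diagonal ρ ^ 2 =
      Matrix.diagonal fun i => 1 - ρ i ^ 2 := by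
    rw [Matrix.diagonal_pow, ← Matrix.diagonal_one, Matrix.diagonal_sub]; rfl
  rw [alphaVec, this, Pi.smul_apply, Matrix.mulVec_diagonal, smul_eq_mul]

theorem bMat_mulVec_apply (n : ℝ) (ρ ξ x : Fin q → ℝ) (i : Fin q) :
    (bMat n ρ ξ *ᵥ x) i =
      n⁻¹ * cnq n q * ((1 - ρ i ^ 2) * ξ i * ∑ j, (ξ j)⁻¹ * x j) + ρ i ^ 2 * x i := by
  have : (1 : Matrix (Fin q) (Fin q) ℝ) - Matrix.diagonal ρ ^ 2 =
      Matrix.diagonal fun i => 1 - ρ i ^ 2 := by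
    rw [Matrix.diagonal_pow, ← Matrix.diagonal_one, Matrix.diagonal_sub]; rfl
  rw [bMat, this, Matrix.add_mulVec, Matrix.smul_mulVec, ← Matrix.mulVec_mulVec,
    Matrix.vecMulVec_mulVec, Matrix.diagonal_pow, Pi.add_apply, Pi.smul_apply,
    Matrix.mulVec_diagonal, Matrix.mulVec_diagonal]
  simp only [dotProduct, Pi.smul_apply, smul_eq_mul, MulOpposite.smul_eq_mul_unop,
    MulOpposite.unop_op, Pi.pow_apply]
  ring

/-- All matrices involved are diagonal in the basis `E`, and `tr(A S⁻¹) = ∑ θ j / ξ j` produces the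
rank-one part of `B`. -/
theorem meanMap_conj_diagonal {E S F : Matrix (Fin q) (Fin q) ℝ}
    (hE : E ∈ Matrix.orthogonalGroup (Fin q) ℝ)
    (hF : F = E * Matrix.diagonal ρ * Eᵀ) (hS : S = E * Matrix.diagonal ξ * Eᵀ)
    (hξ : ∀ i, 0 < ξ i) (θ : Fin q → ℝ) :
    meanMap n S F (E * Matrix.diagonal θ * Eᵀ) =
      E * Matrix.diagonal (alphaVec n ρ ξ + bMat n ρ ξ *ᵥ θ) * Eᵀ := by
  have h1 : Eᵀ * E = 1 := (Matrix.mem_orthogonalGroup_iff' _ _).1 hE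
  have h2 : E * Eᵀ = 1 := (Matrix.mem_orthogonalGroup_iff _ _).1 hE
  have hmul : ∀ x y : Fin q → ℝ, E * Matrix.diagonal x * Eᵀ * (E * Matrix.diagonal y * Eᵀ) =
      E * Matrix.diagonal (fun i => x i * y i) * Eᵀ := by
    intro x y
    calc _ = E * Matrix.diagonal x * (Eᵀ * E) * Matrix.diagonal y * Eᵀ := by
          simp only [Matrix.mul_assoc]
      _ = _ := by rw [h1, Matrix.mul_one, Matrix.mul_assoc E, Matrix.diagonal_mul_diagonal]
  have hFt : Fᵀ = E * Matrix.diagonal ρ * Eᵀ := by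
    rw [hF]; simp [Matrix.transpose_mul, Matrix.mul_assoc]
  have hSi : S⁻¹ = E * Matrix.diagonal (fun i => (ξ i)⁻¹) * Eᵀ := by
    refine Matrix.inv_eq_right_inv ?_
    rw [hS, hmul]
    simp [fun i => mul_inv_cancel₀ (hξ i).ne', h2]
  have htr : ∀ x : Fin q → ℝ, (E * Matrix.diagonal x * Eᵀ).trace = ∑ i, x i := by
    intro x
    rw [Matrix.trace_mul_comm, ← Matrix.mul_assoc, h1, Matrix.one_mul, Matrix.trace_diagonal]
  rw [meanMap, hSi, hmul, htr, hFt, hF, hS, hmul, hmul, hmul, hmul, Fintype.card_fin,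
    ← Matrix.sub_mul, ← Matrix.mul_sub, ← Matrix.smul_mul, ← Matrix.mul_smul, ← Matrix.add_mul,
    ← Matrix.mul_add, Matrix.diagonal_sub, ← Matrix.diagonal_smul, Matrix.diagonal_add]
  congr 3
  funext i
  rw [Pi.add_apply, alphaVec_apply, bMat_mulVec_apply]
  have : ∑ j, θ j * (ξ j)⁻¹ = ∑ j, (ξ j)⁻¹ * θ j := Finset.sum_congr rfl fun _ _ => mul_comm _ _
  simp only [Pi.smul_apply, smul_eq_mul, this]
  ring

/-- `S` is the stationary mean; numerically, `cnq n q * (1 + q / n) = 1`. -/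
theorem alphaVec_add_bMat_mulVec (hn : 0 < n) (hξ : ∀ i, 0 < ξ i) :
    alphaVec n ρ ξ + bMat n ρ ξ *ᵥ ξ = ξ := by
  funext i
  have hq : (0 : ℝ) < n + q := by positivity
  rw [Pi.add_apply, alphaVec_apply, bMat_mulVec_apply]
  simp only [fun j => inv_mul_cancel₀ (hξ j).ne', Finset.sum_const, Finset.card_univ,
    Fintype.card_fin, nsmul_eq_mul, cnq]
  field_simp
  ring

/-- After rescaling by `ξ`, `B` has nonnegative entries and row sums `r i = (1 - ρ i ^ 2) * (q / (n
+ q)) + ρ i ^ 2`, a convex combination of `q / (n + q) < 1` and `1` with positive weight on the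
former. -/
theorem exists_contraction_bMat (hn : 0 < n) (hξ : ∀ i, 0 < ξ i) (hρ : ∀ i, |ρ i| < 1) :
    ∃ k : ℝ, 0 ≤ k ∧ k < 1 ∧ ∀ (C : ℝ) (x : Fin q → ℝ), (∀ i, |x i| ≤ C * ξ i) →
      ∀ i, |(bMat n ρ ξ *ᵥ x) i| ≤ k * C * ξ i := by
  have hq : (0 : ℝ) < n + q := by positivity
  have hρ2 : ∀ i, ρ i ^ 2 < 1 := fun i => (sq_lt_one_iff_abs_lt_one _).2 (hρ i)
  set r : Fin q → ℝ := fun i => (1 - ρ i ^ 2) * (q / (n + q)) + ρ i ^ 2 with hr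
  have hr0 : ∀ i, 0 ≤ r i := fun i => by
    have := (sub_pos.2 (hρ2 i)).le
    positivity
  have hr1 : ∀ i, r i < 1 := fun i => by
    have h1 : (q : ℝ) / (n + q) < 1 := (div_lt_one hq).2 (by linarith)
    have := mul_lt_mul_of_pos_left h1 (sub_pos.2 (hρ2 i))
    simp only [hr]
    linarith
  obtain ⟨k, hk0, hk1, hk⟩ : ∃ k : ℝ, 0 ≤ k ∧ k < 1 ∧ ∀ i, r i ≤ k := by
    -- For `q = 0` there is no largest row sum, and `0` serves.
    rcases isEmpty_or_nonempty (Fin q) with h | h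
    · exact ⟨0, le_rfl, one_pos, fun i => h.elim i⟩
    · obtain ⟨i₀, h₀⟩ := Finite.exists_max r
      exact ⟨r i₀, hr0 _, hr1 _, h₀⟩
  refine ⟨k, hk0, hk1, fun C x hx i => ?_⟩
  have hC : 0 ≤ C := nonneg_of_mul_nonneg_left ((abs_nonneg _).trans (hx i)) (hξ i)
  have hsum : |∑ j, (ξ j)⁻¹ * x j| ≤ q * C := by
    refine (Finset.abs_sum_le_sum_abs _ _).trans ?_
    have : ∀ j ∈ Finset.univ, |(ξ j)⁻¹ * x j| ≤ C := fun j _ => by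
      rw [abs_mul, abs_of_pos (inv_pos.2 (hξ j)), inv_mul_le_iff₀ (hξ j), mul_comm]
      exact hx j
    simpa using Finset.sum_le_card_nsmul _ _ _ this
  have h1 : 0 ≤ n⁻¹ * cnq n q * ((1 - ρ i ^ 2) * ξ i) := by
    have := (sub_pos.2 (hρ2 i)).le
    have := hξ i
    rw [cnq]
    positivity
  calc |(bMat n ρ ξ *ᵥ x) i|
      ≤ n⁻¹ * cnq n q * ((1 - ρ i ^ 2) * ξ i) * |∑ j, (ξ j)⁻¹ * x j| + ρ i ^ 2 * |x i| := by
        rw [bMat_mulVec_apply, ← mul_assoc (n⁻¹ * cnq n q)]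
        refine (abs_add_le _ _).trans_eq ?_
        rw [abs_mul, abs_of_nonneg h1, abs_mul, abs_of_nonneg (sq_nonneg (ρ i))]
    _ ≤ n⁻¹ * cnq n q * ((1 - ρ i ^ 2) * ξ i) * (q * C) + ρ i ^ 2 * (C * ξ i) := by
        gcongr
        exact hx i
    _ = r i * C * ξ i := by
        simp only [hr, cnq]
        field_simp
    _ ≤ k * C * ξ i := by
        have := (hξ i).le
        gcongr
        exact hk i

theorem exists_abs_le_mul (hξ : ∀ i, 0 < ξ i) (x : Fin q → ℝ) :
    ∃ C : ℝ, ∀ i, |x i| ≤ C * ξ i := by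
  refine ⟨∑ j, |x j| / ξ j, fun i => ?_⟩
  rw [← div_le_iff₀ (hξ i)]
  exact Finset.single_le_sum (f := fun j => |x j| / ξ j)
    (fun j _ => div_nonneg (abs_nonneg _) (hξ j).le) (Finset.mem_univ i)

theorem tendsto_bMat_pow_mulVec (hn : 0 < n) (hξ : ∀ i, 0 < ξ i) (hρ : ∀ i, |ρ i| < 1)
    (x : Fin q → ℝ) : Tendsto (fun t => bMat n ρ ξ ^ t *ᵥ x) atTop (𝓝 0) := by
  obtain ⟨k, hk0, hk1, hk⟩ := exists_contraction_bMat hn hξ hρ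
  obtain ⟨C, hC⟩ := exists_abs_le_mul hξ x
  have hb : ∀ t i, |(bMat n ρ ξ ^ t *ᵥ x) i| ≤ k ^ t * C * ξ i := by
    intro t
    induction t with
    | zero => simpa using hC
    | succ t ih =>
      intro i
      rw [pow_succ', ← Matrix.mulVec_mulVec, pow_succ', mul_assoc k]
      exact hk _ _ ih i
  refine tendsto_pi_nhds.2 fun i => squeeze_zero_norm (fun t => hb t i) ?_
  have := ((tendsto_pow_atTop_nhds_zero_of_lt_one hk0 hk1).mul_const C).mul_const (ξ i)
  simpa using this

/-- A kernel vector is fixed by every power of `B`, hence equals the limit `0` of those powers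
applied to it. -/
theorem isUnit_one_sub_bMat (hn : 0 < n) (hξ : ∀ i, 0 < ξ i) (hρ : ∀ i, |ρ i| < 1) :
    IsUnit (1 - bMat n ρ ξ) := by
  rw [← Matrix.mulVec_injective_iff_isUnit, ← Matrix.coe_mulVecLin, injective_iff_map_eq_zero]
  intro x hx
  have hfix : bMat n ρ ξ *ᵥ x = x := by
    rw [Matrix.mulVecLin_apply, Matrix.sub_mulVec, Matrix.one_mulVec, sub_eq_zero] at hx
    exact hx.symm
  have hpow : ∀ t : ℕ, bMat n ρ ξ ^ t *ᵥ x = x := by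
    intro t
    induction t with
    | zero => simp
    | succ t ih => rw [pow_succ, ← Matrix.mulVec_mulVec, hfix, ih]
  have := tendsto_bMat_pow_mulVec hn hξ hρ x
  simp_rw [hpow] at this
  exact tendsto_nhds_unique tendsto_const_nhds this

theorem iterate_affine_eq {m : Type*} [Fintype m] [DecidableEq m] (B : Matrix m m ℝ)
    (a x : m → ℝ) (t : ℕ) :
    (fun y => a + B *ᵥ y)^[t] x = B ^ t *ᵥ x + ∑ τ ∈ Finset.range t, B ^ τ *ᵥ a := by
  induction t with
  | zero => simp
  | succ t ih =>
    rw [Function.iterate_succ_apply', ih, Finset.sum_range_succ', Matrix.mulVec_add,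
      Matrix.mulVec_sum, pow_succ', pow_zero, Matrix.one_mulVec, Matrix.mulVec_mulVec]
    simp only [Matrix.mulVec_mulVec, pow_succ']
    abel

theorem inv_one_sub_mul_one_sub_pow {m : Type*} [Fintype m] [DecidableEq m] {B : Matrix m m ℝ}
    (hB : IsUnit (1 - B)) (t : ℕ) :
    (1 - B)⁻¹ * (1 - B ^ t) = ∑ τ ∈ Finset.range t, B ^ τ := by
  rw [← mul_neg_geom_sum, ← Matrix.mul_assoc,
    Matrix.nonsing_inv_mul _ ((Matrix.isUnit_iff_isUnit_det _).1 hB), Matrix.one_mul]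

end Dynamics

end IWAR

/-! ### Assembly of the theorem. -/

theorem theorem6 {q : ℕ} (n : ℝ) (hn : 0 < n)
    (E S F : Matrix (Fin q) (Fin q) ℝ) (ρ ξ : Fin q → ℝ)
    (hE : E ∈ Matrix.orthogonalGroup (Fin q) ℝ)
    (hF : F = E * Matrix.diagonal ρ * Eᵀ) (hS : S = E * Matrix.diagonal ξ * Eᵀ)
    (hξ : ∀ i, 0 < ξ i) (hρ : ∀ i, |ρ i| < 1) :
    -- `condMean` is a version of the conditional expectation given the initial state
    (∀ (Ω : Type*) [MeasurableSpace Ω] (P : Measure Ω) [IsProbabilityMeasure P]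
      (X : ℕ → Ω → Matrix (Fin q) (Fin q) ℝ), IWAR.IsIWAR n S F P X →
      ∀ t i j, Integrable (fun ω => X t ω i j) P ∧
        P[fun ω => X t ω i j | MeasurableSpace.comap (X 0) inferInstance] =ᵐ[P]
          fun ω => IWAR.condMean n S F t (X 0 ω) i j) ∧
    ∀ θ₀ : Fin q → ℝ, (∀ i, 0 < θ₀ i) →
      -- the means at `Σ_0 = E diag(θ₀) E'` exist
      (∀ t, IsProbabilityMeasure (IWAR.condLaw n S F (E * Matrix.diagonal θ₀ * Eᵀ) t) ∧
        ∀ i j, Integrable (fun M : Matrix (Fin q) (Fin q) ℝ => M i j)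
          (IWAR.condLaw n S F (E * Matrix.diagonal θ₀ * Eᵀ) t)) ∧
      ∃ θ : ℕ → Fin q → ℝ,
        (∀ t, IWAR.condMean n S F t (E * Matrix.diagonal θ₀ * Eᵀ) =
          E * Matrix.diagonal (θ t) * Eᵀ) ∧
        θ 0 = θ₀ ∧
        (∀ t, θ (t + 1) = IWAR.alphaVec n ρ ξ + IWAR.bMat n ρ ξ *ᵥ θ t) ∧
        (∀ t, θ t = IWAR.bMat n ρ ξ ^ t *ᵥ θ₀ +
          ∑ τ ∈ Finset.range t, IWAR.bMat n ρ ξ ^ τ *ᵥ IWAR.alphaVec n ρ ξ) ∧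
        IsUnit (1 - IWAR.bMat n ρ ξ) ∧
        (∀ t, θ t = IWAR.bMat n ρ ξ ^ t *ᵥ θ₀ +
          ((1 - IWAR.bMat n ρ ξ)⁻¹ * (1 - IWAR.bMat n ρ ξ ^ t)) *ᵥ IWAR.alphaVec n ρ ξ) ∧
        Tendsto θ atTop (𝓝 ξ) ∧
        Tendsto (fun t => IWAR.condMean n S F t (E * Matrix.diagonal θ₀ * Eᵀ))
          atTop (𝓝 S) := by
  have h1 : Eᵀ * E = 1 := (Matrix.mem_orthogonalGroup_iff' _ _).1 hE
  have hEu : IsUnit E := ⟨⟨E, Eᵀ, (Matrix.mem_orthogonalGroup_iff _ _).1 hE, h1⟩, rfl⟩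
  have hconj : ∀ x : Fin q → ℝ, (∀ i, 0 < x i) → (E * Matrix.diagonal x * Eᵀ).PosDef :=
    fun x hx => (IWAR.posDef_conj_iff hEu).2 (Matrix.PosDef.diagonal hx)
  have hSp : S.PosDef := hS ▸ hconj ξ hξ
  -- The eigenvalues are `(1 - ρ i ^ 2) * ξ i`; `|ρ i| < 1` thus ensures that the augmented scale is
  -- positive definite.
  have hV : (S - F * S * Fᵀ).PosDef := by
    have : S - F * S * Fᵀ = E * Matrix.diagonal (fun i => (1 - ρ i ^ 2) * ξ i) * Eᵀ := by
      have e : F * S * Fᵀ = E * Matrix.diagonal (fun i => ρ i * ξ i * ρ i) * Eᵀ := by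
        rw [hF, hS]
        calc _ = E * Matrix.diagonal ρ * (Eᵀ * E) * Matrix.diagonal ξ * (Eᵀ * E) *
              Matrix.diagonal ρ * Eᵀ := by
              simp [Matrix.transpose_mul, Matrix.mul_assoc]
          _ = _ := by
              rw [h1, Matrix.mul_one, Matrix.mul_one, Matrix.mul_assoc E,
                Matrix.diagonal_mul_diagonal, Matrix.mul_assoc E, Matrix.diagonal_mul_diagonal]
      rw [e, hS, ← Matrix.sub_mul, ← Matrix.mul_sub, Matrix.diagonal_sub]
      congr 3
      funext i
      ring
    rw [this]
    exact hconj _ fun i => mul_pos (sub_pos.2 ((sq_lt_one_iff_abs_lt_one _).2 (hρ i))) (hξ i)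
  refine ⟨fun Ω _ P _ X h t i j => ⟨h.integrable_entry hn hSp hV t i j,
    h.condExp_entry hn hSp hV t i j⟩, fun θ₀ hθ₀ => ?_⟩
  have hA := hconj θ₀ hθ₀
  have hu := IWAR.isUnit_one_sub_bMat hn hξ hρ
  set B := IWAR.bMat n ρ ξ with hB
  set a := IWAR.alphaVec n ρ ξ with ha
  set θ : ℕ → Fin q → ℝ := fun t => (fun y => a + B *ᵥ y)^[t] θ₀ with hθ
  have hclosed : ∀ t, θ t = B ^ t *ᵥ θ₀ + ∑ τ ∈ Finset.range t, B ^ τ *ᵥ a :=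
    IWAR.iterate_affine_eq B a θ₀
  have hmean : ∀ t, IWAR.condMean n S F t (E * Matrix.diagonal θ₀ * Eᵀ) =
      E * Matrix.diagonal (θ t) * Eᵀ := by
    intro t
    rw [IWAR.condMean_eq_iterate hn hSp hV hA]
    induction t with
    | zero => rfl
    | succ t ih =>
      rw [Function.iterate_succ_apply', ih, IWAR.meanMap_conj_diagonal hE hF hS hξ]
      simp only [hθ, Function.iterate_succ_apply']
      rfl
  have hlim : Tendsto θ atTop (𝓝 ξ) := by
    have hfix : ∀ t, ξ = B ^ t *ᵥ ξ + ∑ τ ∈ Finset.range t, B ^ τ *ᵥ a := fun t => by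
      rw [← IWAR.iterate_affine_eq,
        Function.iterate_fixed (IWAR.alphaVec_add_bMat_mulVec hn hξ) t]
    -- Subtracting the closed form of the constant orbit at `ξ` removes the sum in `a`.
    have hdiff : ∀ t, θ t = B ^ t *ᵥ (θ₀ - ξ) + ξ := fun t => by
      rw [hclosed, Matrix.mulVec_sub, sub_add_eq_add_sub, eq_sub_iff_add_eq, add_right_comm,
        add_assoc, ← hfix t]
    rw [funext hdiff]
    simpa using (IWAR.tendsto_bMat_pow_mulVec hn hξ hρ (θ₀ - ξ)).add_const ξ
  refine ⟨fun t => ?_, θ, hmean, rfl, fun t => Function.iterate_succ_apply' _ _ _, hclosed, hu,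
    fun t => ?_, hlim, ?_⟩
  · obtain ⟨h2, -, h3, -⟩ := IWAR.condLaw_moments hn hSp hV hA t
    exact ⟨h2, h3⟩
  · rw [IWAR.inv_one_sub_mul_one_sub_pow hu, Matrix.sum_mulVec]
    exact hclosed t
  · simp_rw [hmean]
    have hc : Continuous fun x : Fin q → ℝ => E * Matrix.diagonal x * Eᵀ := by fun_prop
    rw [hS]
    exact (hc.tendsto ξ).comp hlim
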